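/- Let $X$ be a standard Borel space (for instance a closed subset of $\mathbb R^d$), let $\rho$ be a probability measure on $X\times\mathbb R$ with $\int y^2\,d\rho<\infty$, marginal $\rho_X$ on $X$ and conditional distributions $\rho(\cdot\mid x)$. Let $f_\rho(x)=\int y\,d\rho(y\mid x)$ be the regression function, $\mathcal E(f)=\int (f(x)-y)^2\,d\rho(x,y)$ the risk, and $\|\cdot\|_\rho$ the norm of $L^2(\rho_X)$. Let $\mu$ be a probability measure on a measurable space $V$, let $\phi:V\times X\to\mathbb R$, $\phi_v=\phi(v,\cdot)$, be measurable and square-integrable with respect to $\mu\otimes\rho_X$, with $\phi(\cdot,x)\in L^2(\mu)$ for every $x\in X$, and let $K:X\times X\to\mathbb R$ be a measurable kernel with $$K(x,x')=\int_V \phi(v,x)\phi(v,x')\,d\mu(v)\qquad\text{for all }x,x'\in X .$$ Let $L_K:L^2(\rho_X)\to L^2(\rho_X)$, $L_Kf=\int_X f(x)K(x,\cdot)\,d\rho_X(x)$. Let $\kappa\ge 1$, $0<\zeta\le 1$, $R>0$, $0\le\gamma<1$, $c_\gamma>0$ and assume: 1. $K(x,x)\le\kappa^2$ for all $x\in X$,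 and $\phi_v(x)\phi_v(x')\le\kappa^2$ for $\mu\otimes\rho_X\otimes\rho_X$-almost all $(v,x,x')$; 2. $\|L_K^{-\zeta}f_\rho\|_\rho\le R$, that is, $f_\rho=L_K^{\zeta}g$ $\rho_X$-almost everywhere for some $g\in L^2(\rho_X)$ with $\|g\|_\rho\le R$; 3. $\operatorname{tr}\big(L_K(L_K+\lambda I)^{-1}\big)\le c_\gamma\lambda^{-\gamma}$ for all $\lambda>0$. Let $T\ge 2$ be an integer, let $z_t=(x_t,y_t)$, $1\le t\le T$, be i.i.d. with law $\rho$ and, independently of them, $v_1,\dots,v_T$ i.i.d. with law $\mu$. For $t=1,\dots,T$ put $f_1=0$ and $$f_{t+1}=(1-\eta_t\lambda)f_t-\eta_t\,(f_t(x_t)-y_t)\,\phi_{v_t}(x_t)\,\phi_{v_t},$$ with $$\eta_t=\frac{\zeta}{3\kappa^2(3c_\gamma+\kappa^2)(1+\zeta)}\;t^{-\frac{2\zeta+\gamma}{2\zeta+\gamma+1}},\qquad \lambda=T^{-\frac{1}{2\zeta+\gamma+1}+\frac{\epsilon}{2\zeta}},\qquad 0<\epsilon\le\frac{2\zeta}{2\zeta+\gamma+1}.$$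 Then $$\mathbb E\big[\|f_{T+1}-f_\rho\|_\rho^2\big]\le C\,T^{-\frac{2\zeta}{2\zeta+\gamma+1}+\epsilon}\,\ln T ,$$ where the constant $C$ depends only on $\zeta,\gamma,c_\gamma,R,\kappa,\epsilon$ and an upper bound for $\mathcal E(f_\rho)$; in particular it does not depend on $T$. -/

import Mathlib

open MeasureTheory ProbabilityTheory
open scoped ENNReal

noncomputable section

namespace DoublyStochastic

/-! ### Square loss, regression function -/

section Risk

variable {X : Type*} [MeasurableSpace X]

/-- The regression function `f_ρ(x) = ∫ y dρ(y | x)`, where `ρ(· | x)` is the regular conditional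
distribution of the output given the input. -/
def regressionFun (ρ : Measure (X × ℝ)) [IsFiniteMeasure ρ] (x : X) : ℝ :=
  ∫ y, y ∂(ρ.condKernel x)

/-- The expected risk `𝓔(f) = ∫ (f(x) - y)² dρ(x, y)`. -/
def risk (ρ : Measure (X × ℝ)) (f : X → ℝ) : ℝ :=
  ∫ z, (f z.1 - z.2) ^ 2 ∂ρ

/-- The squared `L²(ρ_X)` distance `‖f - g‖_ρ²`, valued in `[0, ∞]`. -/
def sqDist (ρX : Measure X) (f g : X → ℝ) : ℝ≥0∞ :=
  ∫⁻ x, ENNReal.ofReal ((f x - g x) ^ 2) ∂ρX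

end Risk

/-! ### The algorithm -/

section Algorithm

variable {X V : Type*}

/-- The doubly stochastic learning algorithm. `iterate φ η lam t s` is the function `f_{t+1}` produced
after `t` steps from the data `s 0, …, s (t-1)`, where `s (k-1) = (z_k, v_k) = ((x_k, y_k), v_k)` is
used at step `k`:
`f_1 = 0`, `f_{k+1} = (1 - η_k λ) f_k - η_k (f_k(x_k) - y_k) φ_{v_k}(x_k) φ_{v_k}`. -/
def iterate (φ : V → X → ℝ) (η : ℕ → ℝ) (lam : ℝ) :
    (t : ℕ) → (Fin t → (X × ℝ) × V) → X → ℝ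
  | 0, _ => fun _ => 0
  | t + 1, s => fun x =>
      (1 - η (t + 1) * lam) * iterate φ η lam t (Fin.init s) x
        - η (t + 1)
          * (iterate φ η lam t (Fin.init s) (s (Fin.last t)).1.1 - (s (Fin.last t)).1.2)
          * φ (s (Fin.last t)).2 (s (Fin.last t)).1.1
          * φ (s (Fin.last t)).2 x

end Algorithm

/-! ### The integral operator of a kernel -/

section IntegralOperator

variable {X : Type*} [MeasurableSpace X]

/-- A measurable and bounded kernel. -/
def IsBoundedKernel (K : X → X → ℝ) : Prop :=
  Measurable (Function.uncurry K) ∧ ∃ M : ℝ, ∀ x x', |K x x'| ≤ M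

/-- The function `x' ↦ ∫ f(x) K(x, x') dρ_X(x)`. -/
def kernelIntegral (ρX : Measure X) (K : X → X → ℝ) (f : X → ℝ) (x' : X) : ℝ :=
  ∫ x, f x * K x x' ∂ρX

variable {ρX : Measure X} [IsFiniteMeasure ρX] {K : X → X → ℝ}

theorem integrable_mul_kernel (hK : IsBoundedKernel K) (f : Lp ℝ 2 ρX) (x' : X) :
    Integrable (fun x => f x * K x x') ρX := by
  obtain ⟨hm, M, hM⟩ := hK
  have hf : Integrable f ρX := (Lp.memLp f).integrable (by norm_num)
  refine hf.mul_bdd (c := M) ?_ ?_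
  · exact (hm.comp (measurable_id.prodMk measurable_const)).aestronglyMeasurable
  · exact Filter.Eventually.of_forall fun x => by simpa using hM x x'

theorem memLp_kernelIntegral (hK : IsBoundedKernel K) (f : Lp ℝ 2 ρX) :
    MemLp (kernelIntegral ρX K f) 2 ρX := by
  obtain ⟨hm, M, hM⟩ := hK
  have hf : Integrable f ρX := (Lp.memLp f).integrable (by norm_num)
  have hsm : StronglyMeasurable (kernelIntegral ρX K f) := by
    have h1 : StronglyMeasurable (Function.uncurry fun (x' : X) (x : X) => f x * K x x') := by
      have h2 : Measurable fun p : X × X => K p.2 p.1 :=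
        hm.comp (measurable_snd.prodMk measurable_fst)
      exact (((Lp.stronglyMeasurable f).measurable.comp measurable_snd).mul h2).stronglyMeasurable
    exact h1.integral_prod_right
  refine MemLp.of_bound hsm.aestronglyMeasurable (M * ∫ x, ‖f x‖ ∂ρX)
    (Filter.Eventually.of_forall fun x' => ?_)
  have := norm_integral_le_of_norm_le (μ := ρX) (f := fun x => f x * K x x')
    (hf.norm.const_mul M) (Filter.Eventually.of_forall fun x => by
      rw [norm_mul, mul_comm]
      exact mul_le_mul_of_nonneg_right (by simpa using hM x x') (norm_nonneg _))
  rw [integral_const_mul] at this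
  exact this

/-- The integral operator as a linear map. -/
def integralLinearMap (hK : IsBoundedKernel K) : Lp ℝ 2 ρX →ₗ[ℝ] Lp ℝ 2 ρX where
  toFun f := (memLp_kernelIntegral hK f).toLp _
  map_add' f g := by
    rw [← MemLp.toLp_add]
    refine MemLp.toLp_congr _ _ (Filter.Eventually.of_forall fun x' => ?_)
    simp only [kernelIntegral, Pi.add_apply]
    rw [← integral_add (integrable_mul_kernel hK f x') (integrable_mul_kernel hK g x')]
    refine integral_congr_ae ?_
    filter_upwards [Lp.coeFn_add f g] with x hx
    rw [hx, Pi.add_apply, add_mul]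
  map_smul' c f := by
    rw [RingHom.id_apply, ← MemLp.toLp_const_smul]
    refine MemLp.toLp_congr _ _ (Filter.Eventually.of_forall fun x' => ?_)
    simp only [kernelIntegral, Pi.smul_apply, smul_eq_mul]
    rw [← integral_const_mul]
    refine integral_congr_ae ?_
    filter_upwards [Lp.coeFn_smul c f] with x hx
    rw [hx, Pi.smul_apply, smul_eq_mul, mul_assoc]

theorem exists_bound_integralLinearMap (hK : IsBoundedKernel K) :
    ∃ C : ℝ, ∀ f : Lp ℝ 2 ρX, ‖integralLinearMap hK f‖ ≤ C * ‖f‖ := by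
  obtain ⟨M, hM⟩ := hK.2
  set a : ℝ := (measureUnivNNReal ρX : ℝ) ^ (2 : ℝ≥0∞).toReal⁻¹ with ha
  set b : ℝ := (ρX Set.univ ^ (1 / (1 : ℝ≥0∞).toReal - 1 / (2 : ℝ≥0∞).toReal)).toReal with hb
  refine ⟨a * (|M| * b), fun f => ?_⟩
  have hf : Integrable f ρX := (Lp.memLp f).integrable (by norm_num)
  have h1 : ∫ x, ‖f x‖ ∂ρX ≤ b * ‖f‖ := by
    have h := eLpNorm_le_eLpNorm_mul_rpow_measure_univ (μ := ρX) (p := 1) (q := 2) (by norm_num)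
      (Lp.aestronglyMeasurable f)
    rw [integral_norm_eq_lintegral_enorm hf.aestronglyMeasurable, ← eLpNorm_one_eq_lintegral_enorm,
      Lp.norm_def, hb, mul_comm, ← ENNReal.toReal_mul]
    refine ENNReal.toReal_mono (ENNReal.mul_ne_top (Lp.eLpNorm_ne_top f) ?_) h
    exact ENNReal.rpow_ne_top_of_nonneg (by norm_num) (measure_ne_top _ _)
  have h2 : ∀ᵐ x' ∂ρX, ‖integralLinearMap hK f x'‖ ≤ |M| * (b * ‖f‖) := by
    filter_upwards [MemLp.coeFn_toLp (memLp_kernelIntegral hK f)] with x' hx'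
    have hx : integralLinearMap hK f x' = kernelIntegral ρX K f x' := hx'
    rw [hx]
    refine le_trans (norm_integral_le_of_norm_le (hf.norm.const_mul |M|)
      (Filter.Eventually.of_forall fun x => ?_)) ?_
    · rw [norm_mul, mul_comm]
      exact mul_le_mul_of_nonneg_right ((hM x x').trans (le_abs_self M)) (norm_nonneg _)
    · rw [integral_const_mul]
      exact mul_le_mul_of_nonneg_left h1 (abs_nonneg M)
  have h3 : 0 ≤ |M| * (b * ‖f‖) :=
    mul_nonneg (abs_nonneg M) (mul_nonneg ENNReal.toReal_nonneg (norm_nonneg f))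
  refine (Lp.norm_le_of_ae_bound h3 h2).trans (le_of_eq ?_)
  rw [ha]
  ring

open Classical in
/-- The integral operator `L_K : L²(ρ_X) → L²(ρ_X)`, `L_K f = ∫ f(x) K(x, ·) dρ_X(x)`, of a bounded
measurable kernel (and `0` for other kernels). -/
def integralOp (ρX : Measure X) [IsFiniteMeasure ρX] (K : X → X → ℝ) :
    Lp ℝ 2 ρX →L[ℝ] Lp ℝ 2 ρX :=
  if hK : IsBoundedKernel K then
    (integralLinearMap hK).mkContinuousOfExistsBound (exists_bound_integralLinearMap hK)
  else 0

theorem coeFn_integralOp (hK : IsBoundedKernel K) (f : Lp ℝ 2 ρX) :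
    integralOp ρX K f =ᵐ[ρX] kernelIntegral ρX K f := by
  rw [integralOp, dif_pos hK]
  exact MemLp.coeFn_toLp (memLp_kernelIntegral hK f)

end IntegralOperator

/-! ### Powers and traces of positive operators -/

section Operators

variable {H : Type*} [NormedAddCommGroup H] [InnerProductSpace ℝ H] [CompleteSpace H]

/-- The eigenspace `{u | L u = σ u}`, as the kernel of `L - σ I`. -/
abbrev eigenKer (L : H →L[ℝ] H) (σ : ℝ) : Submodule ℝ H :=
  (L - σ • ContinuousLinearMap.id ℝ H).ker

/-- The value at `f` of the power `L ^ r`, `r > 0`, of a compact positive self-adjoint operator, by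
the spectral theorem: `L ^ r = ∑_σ σ ^ r P_σ`, where `P_σ` is the orthogonal projection onto the
eigenspace of `σ` (it vanishes if `σ` is not an eigenvalue). -/
def operatorPow (L : H →L[ℝ] H) (r : ℝ) (f : H) : H :=
  ∑' σ : ℝ, σ ^ r • (eigenKer L σ).starProjection f

/-- The trace `∑ i, ⟪e i, A (e i)⟫` of a positive operator with respect to an orthonormal basis `e`;
it takes values in `[0, ∞]` and is independent of the basis. -/
def operatorTrace (A : H →L[ℝ] H) : ℝ≥0∞ :=
  ∑' i, ENNReal.ofReal
    (inner ℝ ((exists_hilbertBasis ℝ H).choose_spec.choose i)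
      (A ((exists_hilbertBasis ℝ H).choose_spec.choose i)))

/-- The effective dimension `tr (L (L + λ I)⁻¹)`. -/
def effectiveDim (L : H →L[ℝ] H) (lam : ℝ) : ℝ≥0∞ :=
  operatorTrace (L * Ring.inverse (L + lam • (1 : H →L[ℝ] H)))

end Operators

/-! ### The assumptions -/

section Assumptions

variable {X V : Type*} [MeasurableSpace X] [MeasurableSpace V]

/-- The random feature setting: `K` is a measurable kernel with
`K(x, x') = ∫ φ(v, x) φ(v, x') dμ(v) = ⟪φ(·, x), φ(·, x')⟫` in `L²(μ)` for all `x, x'`, with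
`φ ∈ L²(μ ⊗ ρ_X)`. -/
structure IsFeatureKernel (ρX : Measure X) (μ : Measure V) (φ : V → X → ℝ) (K : X → X → ℝ) :
    Prop where
  measurable_feature : Measurable (Function.uncurry φ)
  memLp_feature : MemLp (Function.uncurry φ) 2 (μ.prod ρX)
  memLp_section : ∀ x, MemLp (fun v => φ v x) 2 μ
  measurable_kernel : Measurable (Function.uncurry K)
  kernel_eq : ∀ x x', K x x' = ∫ v, φ v x * φ v x' ∂μ

/-- Boundedness: `K(x, x) ≤ κ²` for all `x`, and `φ_v(x) φ_v(x') ≤ κ²` almost surely. -/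
structure BoundedFeatures (ρX : Measure X) (μ : Measure V) (φ : V → X → ℝ) (K : X → X → ℝ) (κ : ℝ) :
    Prop where
  kernel_diag_le : ∀ x, K x x ≤ κ ^ 2
  feature_mul_le : ∀ᵐ p ∂(μ.prod (ρX.prod ρX)), φ p.1 p.2.1 * φ p.1 p.2.2 ≤ κ ^ 2

/-- Regularity `‖L_K^{-ζ} f‖_ρ ≤ R`: `f = L_K^ζ g` for some `g ∈ L²(ρ_X)` with `‖g‖_ρ ≤ R`. -/
def SourceCondition (ρX : Measure X) [IsFiniteMeasure ρX] (K : X → X → ℝ) (ζ R : ℝ) (f : X → ℝ) :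
    Prop :=
  ∃ g : Lp ℝ 2 ρX, ‖g‖ ≤ R ∧ ((operatorPow (integralOp ρX K) ζ g : Lp ℝ 2 ρX) : X → ℝ) =ᵐ[ρX] f

/-- Capacity: `tr (L_K (L_K + λ I)⁻¹) ≤ c λ^{-γ}` for all `λ > 0`. -/
def CapacityCondition (ρX : Measure X) [IsFiniteMeasure ρX] (K : X → X → ℝ) (γ c : ℝ) : Prop :=
  ∀ lam : ℝ, 0 < lam → effectiveDim (integralOp ρX K) lam ≤ ENNReal.ofReal (c * lam ^ (-γ))

/-- In the random feature setting with bounded features the kernel is bounded, so that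
`integralOp ρX K` is the genuine integral operator. -/
theorem IsFeatureKernel.isBoundedKernel {ρX : Measure X} {μ : Measure V} {φ : V → X → ℝ}
    {K : X → X → ℝ} {κ : ℝ} (h : IsFeatureKernel ρX μ φ K) (hb : BoundedFeatures ρX μ φ K κ) :
    IsBoundedKernel K := by
  refine ⟨h.measurable_kernel, κ ^ 2, fun x x' => ?_⟩
  have h1 := (h.memLp_section x).integrable_sq
  have h2 := (h.memLp_section x').integrable_sq
  have hle : |K x x'| ≤ ∫ v, (φ v x ^ 2 + φ v x' ^ 2) / 2 ∂μ := by
    rw [h.kernel_eq, ← Real.norm_eq_abs]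
    refine norm_integral_le_of_norm_le ((h1.add h2).div_const 2)
      (Filter.Eventually.of_forall fun v => ?_)
    rw [Real.norm_eq_abs, abs_le]
    constructor <;> nlinarith [sq_nonneg (φ v x + φ v x'), sq_nonneg (φ v x - φ v x')]
  rw [integral_div, integral_add h1 h2] at hle
  have e1 := hb.kernel_diag_le x
  have e2 := hb.kernel_diag_le x'
  rw [h.kernel_eq] at e1 e2
  simp only [← pow_two] at e1 e2
  linarith

end Assumptions

end DoublyStochastic

end

open MeasureTheory ProbabilityTheory
open scoped ENNReal

noncomputable section

namespace DoublyStochastic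

/-! ### Quadratic forms of powers of a positive operator -/

section PowerForms

variable {H : Type*} [NormedAddCommGroup H] [InnerProductSpace ℝ H]

/-! Write `L` for the integral operator, `h` for the class of the regression function in `L²(ρ_X)`
and `p = (L + λ)⁻¹ L h`. The error splits at `p`. The source condition gives `‖p - h‖ ≤ λ^ζ R`, and
`λ^(2ζ)` is exactly `T^(-α + ε)` with `α = 2ζ / (2ζ + γ + 1)`.

For `f_t - p`, the conditional mean of one random gradient is `L (f_t - h)`, and `L p + λ p = L h`,
so the mean step is the linear map `1 - η (L + λ)` applied to `f_t - p`. Unrolling with a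
bias-variance inequality at each step (`meanSqDist_le_sum`) leaves a bias `‖Π p‖²` and a sum over
`j` of `η_j² κ²` times the expected risk of `f_j` times `E ‖Π_j φ_v‖²`, where `Π_j` is the product
of the later mean steps.

The feature trace `E ‖Π_j φ_v‖²` is bounded in two ways, with `s` the sum of the step sizes after
`j`. Ridge contraction gives `κ² exp (-2 λ s)`. The operator inequality `Π L Π ≤ s⁻¹ L (L + s⁻¹)⁻¹`
(`inner_map_propagator_le`) and the capacity condition at `s⁻¹` give `c s^(γ - 1)`.

The risks are not known to be bounded in advance. Inserting the second trace bound yields a discrete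
Volterra inequality for them; its weights have sums tending to `0`, so the risks are bounded
uniformly in `t` and `T` (`exists_volterra_bound`). In the final sum the terms with `j < T/2` are
exponentially small, because `λ s` is at least of order `T^(ε / (2ζ))`; the remaining terms add up
to order `T^(-α) log T`. -/

/-- The quadratic form `⟪Lⁿ u, u⟫`. -/
def powForm (L : H →L[ℝ] H) (n : ℕ) (u : H) : ℝ := inner ℝ ((L ^ n) u) u

theorem powForm_zero (L : H →L[ℝ] H) (u : H) : powForm L 0 u = ‖u‖ ^ 2 := by
  simp [powForm]

theorem powForm_one (L : H →L[ℝ] H) (u : H) : powForm L 1 u = inner ℝ (L u) u := by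
  simp [powForm]

variable {L : H →L[ℝ] H} {m : ℝ}

/-- One factor `L` moves across the inner product. Two-step induction then reduces statements about
all powers to `n = 0` and `n = 1`, so no square root of `L` is needed. -/
theorem powForm_add_two (hL : L.IsPositive) (n : ℕ) (u : H) :
    powForm L (n + 2) u = powForm L n (L u) := by
  rw [powForm, powForm, pow_succ, pow_succ', mul_apply_eq_comp,
    mul_apply_eq_comp]
  exact hL.inner_left_eq_inner_right _ _

theorem powForm_nonneg (hL : L.IsPositive) (n : ℕ) (u : H) : 0 ≤ powForm L n u := by
  induction n using Nat.twoStepInduction generalizing u with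
  | zero => rw [powForm_zero]; positivity
  | one => rw [powForm_one]; exact hL.inner_nonneg_left u
  | more n ih _ => rw [powForm_add_two hL]; exact ih _

/-- Positivity at `u - m⁻¹ L u`, where the term `⟪L (L u), L u⟫` is bounded by `m ‖L u‖²`. In
operator form this is `L² ≤ m L`. -/
theorem norm_map_sq_le (hL : L.IsPositive) (hm0 : 0 < m) (hm : ∀ u, inner ℝ (L u) u ≤ m * ‖u‖ ^ 2)
    (u : H) : ‖L u‖ ^ 2 ≤ m * inner ℝ (L u) u := by
  have h := hL.inner_nonneg_left (u - m⁻¹ • L u)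
  have h2 := hm (L u)
  have h3 : inner ℝ (L (L u)) u = ‖L u‖ ^ 2 := by
    rw [hL.inner_left_eq_inner_right, real_inner_self_eq_norm_sq]
  simp only [map_sub, map_smul, inner_sub_left, inner_sub_right, inner_smul_left, inner_smul_right,
    RCLike.conj_to_real, real_inner_self_eq_norm_sq, h3] at h
  have h4 : m⁻¹ * (m⁻¹ * inner ℝ (L (L u)) (L u)) ≤ m⁻¹ * ‖L u‖ ^ 2 := by
    refine mul_le_mul_of_nonneg_left ?_ (by positivity)
    rw [inv_mul_le_iff₀ hm0]
    exact h2
  have h5 : m⁻¹ * ‖L u‖ ^ 2 ≤ inner ℝ (L u) u := by linarith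
  rwa [inv_mul_le_iff₀ hm0] at h5

theorem powForm_succ_le (hL : L.IsPositive) (hm0 : 0 < m)
    (hm : ∀ u, inner ℝ (L u) u ≤ m * ‖u‖ ^ 2) (n : ℕ) (u : H) :
    powForm L (n + 1) u ≤ m * powForm L n u := by
  induction n using Nat.twoStepInduction generalizing u with
  | zero => rw [powForm_zero, zero_add, powForm_one]; exact hm u
  | one => rw [powForm_add_two hL, powForm_zero, powForm_one]; exact norm_map_sq_le hL hm0 hm u
  | more n ih _ =>
    rw [add_right_comm, powForm_add_two hL, powForm_add_two hL]
    exact ih _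

theorem powForm_sub_smul (hL : L.IsPositive) (n : ℕ) (η lam : ℝ) (u : H) :
    powForm L n (u - η • (L u + lam • u)) =
      (1 - η * lam) ^ 2 * powForm L n u - 2 * η * (1 - η * lam) * powForm L (n + 1) u
        + η ^ 2 * powForm L (n + 2) u := by
  have h1 : inner ℝ ((L ^ n) (L u)) u = powForm L (n + 1) u := by
    rw [powForm, pow_succ, mul_apply_eq_comp]
  have h2 : inner ℝ ((L ^ n) u) (L u) = powForm L (n + 1) u := by
    rw [powForm, pow_succ', mul_apply_eq_comp, hL.inner_left_eq_inner_right]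
  have h3 : inner ℝ ((L ^ n) (L u)) (L u) = powForm L (n + 2) u := (powForm_add_two hL n u).symm
  have h4 : inner ℝ ((L ^ n) u) u = powForm L n u := rfl
  rw [powForm]
  simp only [map_sub, map_add, map_smul, inner_sub_left, inner_sub_right, inner_add_left,
    inner_add_right, inner_smul_left, inner_smul_right, RCLike.conj_to_real, h1, h2, h3, h4]
  ring

/-- By `L^(n+2) ≤ m L^(n+1)`, the step-size condition is just what makes `2 (1 - ηλ) - ηm ≥ 1`. The
first term of the bound carries the ridge contraction, the second the decrease that telescopes in
`sum_mul_powForm_propagator_le`. -/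
theorem powForm_sub_smul_le (hL : L.IsPositive) (hm0 : 0 < m)
    (hm : ∀ u, inner ℝ (L u) u ≤ m * ‖u‖ ^ 2) {η lam : ℝ} (hη : 0 ≤ η)
    (hηm : η * (m + 2 * lam) ≤ 1) (n : ℕ) (u : H) :
    powForm L n (u - η • (L u + lam • u)) ≤
      (1 - η * lam) ^ 2 * powForm L n u - η * powForm L (n + 1) u := by
  rw [powForm_sub_smul hL]
  have h1 := powForm_succ_le hL hm0 hm (n + 1) u
  have h2 := powForm_nonneg hL (n + 1) u
  have h3 : η ^ 2 * powForm L (n + 2) u ≤ η ^ 2 * (m * powForm L (n + 1) u) :=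
    mul_le_mul_of_nonneg_left h1 (sq_nonneg η)
  have h4 : 0 ≤ η * (1 - η * (m + 2 * lam)) * powForm L (n + 1) u :=
    mul_nonneg (mul_nonneg hη (by linarith)) h2
  nlinarith

end PowerForms

/-! ### Products of gradient steps -/

section Propagator

open Polynomial

variable {H : Type*} [NormedAddCommGroup H] [InnerProductSpace ℝ H]

/-- The product `∏_{k < j ≤ t} (1 - η_j (L + λ))`. -/
def propagator (L : H →L[ℝ] H) (lam : ℝ) (η : ℕ → ℝ) (k t : ℕ) : H →L[ℝ] H :=
  aeval L (∏ j ∈ Finset.Ioc k t, (1 - C (η j) * (X + C lam)))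

variable {L : H →L[ℝ] H} {lam m : ℝ} {η : ℕ → ℝ}

theorem propagator_self (k : ℕ) : propagator L lam η k k = 1 := by
  simp [propagator]

theorem aeval_step (η₀ : ℝ) :
    aeval L (1 - C η₀ * (X + C lam)) = 1 - η₀ • (L + lam • (1 : H →L[ℝ] H)) := by
  simp [Algebra.algebraMap_eq_smul_one, smul_add]

theorem propagator_succ {k t : ℕ} (h : k ≤ t) :
    propagator L lam η k (t + 1) =
      (1 - η (t + 1) • (L + lam • (1 : H →L[ℝ] H))) * propagator L lam η k t := by
  rw [propagator, Finset.prod_Ioc_succ_top h, mul_comm, map_mul, aeval_step, propagator]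

/-- Self-adjointness passes from `L` to real polynomials in `L`. Treating the propagator as a
polynomial gives this and its commutation with `L` without ordering the factors. -/
theorem inner_aeval_left (hL : L.IsPositive) (p : ℝ[X]) (u w : H) :
    inner ℝ (aeval L p u) w = inner ℝ u (aeval L p w) := by
  induction p using Polynomial.induction_on' generalizing u w with
  | add p q hp hq => simp [inner_add_left, inner_add_right, hp, hq]
  | monomial n a =>
    simp only [aeval_monomial, Algebra.algebraMap_eq_smul_one, smul_mul_assoc, one_mul,
      smul_apply, inner_smul_left, inner_smul_right, RCLike.conj_to_real]
    congr 1
    induction n generalizing u w with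
    | zero => simp
    | succ n ih =>
      rw [pow_succ, mul_apply_eq_comp, ih, hL.inner_left_eq_inner_right,
        ← mul_apply_eq_comp, ← pow_succ', pow_succ]

theorem inner_propagator_left (hL : L.IsPositive) (k t : ℕ) (u w : H) :
    inner ℝ (propagator L lam η k t u) w = inner ℝ u (propagator L lam η k t w) :=
  inner_aeval_left hL _ u w

theorem propagator_succ_apply {k t : ℕ} (h : k ≤ t) (u : H) :
    propagator L lam η k (t + 1) u = propagator L lam η k t u
      - η (t + 1) • (L (propagator L lam η k t u) + lam • propagator L lam η k t u) := by
  rw [propagator_succ h]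
  simp

theorem propagator_map (k t : ℕ) (u : H) :
    propagator L lam η k t (L u) = L (propagator L lam η k t u) := by
  have h : propagator L lam η k t * L = L * propagator L lam η k t := by
    rw [propagator]
    nth_rewrite 2 [← aeval_X (R := ℝ) L]
    nth_rewrite 3 [← aeval_X (R := ℝ) L]
    rw [← map_mul, ← map_mul, mul_comm]
  exact DFunLike.congr_fun h u

theorem powForm_propagator_le_exp (hL : L.IsPositive) (hm0 : 0 < m)
    (hm : ∀ u, inner ℝ (L u) u ≤ m * ‖u‖ ^ 2) (hη : ∀ j, 0 ≤ η j)
    (hηm : ∀ j, 1 ≤ j → η j * (m + 2 * lam) ≤ 1) (n : ℕ) {k t : ℕ} (hkt : k ≤ t) (u : H) :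
    powForm L n (propagator L lam η k t u) ≤
      Real.exp (-(2 * lam * ∑ j ∈ Finset.Ioc k t, η j)) * powForm L n u := by
  induction t, hkt using Nat.le_induction with
  | base => simp [propagator_self]
  | succ t hkt ih =>
    rw [propagator_succ_apply hkt, Finset.sum_Ioc_succ_top hkt]
    set w := propagator L lam η k t u
    have h1 := powForm_sub_smul_le hL hm0 hm (hη (t + 1)) (hηm (t + 1) (by omega)) n w
    have h2 := mul_nonneg (hη (t + 1)) (powForm_nonneg hL (n + 1) w)
    have h3 : (1 - η (t + 1) * lam) ^ 2 ≤ Real.exp (-(2 * lam * η (t + 1))) := by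
      have e : Real.exp (-(2 * lam * η (t + 1))) = Real.exp (-(η (t + 1) * lam)) ^ 2 := by
        rw [← Real.exp_nat_mul]
        congr 1
        push_cast
        ring
      rw [e]
      refine pow_le_pow_left₀ ?_ (by linarith [Real.add_one_le_exp (-(η (t + 1) * lam))]) 2
      nlinarith [hηm (t + 1) (by omega), 
        mul_nonneg (hη (t + 1)) hm0.le]
    calc _ ≤ (1 - η (t + 1) * lam) ^ 2 * powForm L n w := by linarith
      _ ≤ Real.exp (-(2 * lam * η (t + 1))) *
            (Real.exp (-(2 * lam * ∑ j ∈ Finset.Ioc k t, η j)) * powForm L n u) := by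
        refine mul_le_mul h3 ih (powForm_nonneg hL n w) (Real.exp_nonneg _)
      _ = _ := by
        rw [← mul_assoc, ← Real.exp_add]
        congr 2
        ring

/-- The left side is a Lyapunov function of `t`: a step lowers the form of order `n` by at least `η`
times the form of order `n + 1`, which pays for the growth of the prefactor, and the form of order
`n + 1` does not increase. It plays the role of a spectral bound on `σ Π(σ)²` by `1 / s`. -/
theorem sum_mul_powForm_propagator_le (hL : L.IsPositive) (hm0 : 0 < m)
    (hm : ∀ u, inner ℝ (L u) u ≤ m * ‖u‖ ^ 2) (hη : ∀ j, 0 ≤ η j) (hlam : 0 ≤ lam)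
    (hηm : ∀ j, 1 ≤ j → η j * (m + 2 * lam) ≤ 1) (n : ℕ) {k t : ℕ} (hkt : k ≤ t) (u : H) :
    (∑ j ∈ Finset.Ioc k t, η j) * powForm L (n + 1) (propagator L lam η k t u)
      + powForm L n (propagator L lam η k t u) ≤ powForm L n u := by
  induction t, hkt using Nat.le_induction with
  | base => simp [propagator_self]
  | succ t hkt ih =>
    rw [propagator_succ_apply hkt, Finset.sum_Ioc_succ_top hkt]
    set w := propagator L lam η k t u
    set s := ∑ j ∈ Finset.Ioc k t, η j with hs
    have hs0 : 0 ≤ s := Finset.sum_nonneg fun j _ => hη j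
    have h5 : 0 ≤ η (t + 1) * lam := mul_nonneg (hη _) hlam
    have h6 : η (t + 1) * lam ≤ 1 := by
      nlinarith [hηm (t + 1) (by omega), mul_nonneg (hη (t + 1)) hm0.le]
    have h4 : (1 - η (t + 1) * lam) ^ 2 ≤ 1 := by nlinarith
    have h1 : ∀ i, powForm L i (w - η (t + 1) • (L w + lam • w)) ≤
        powForm L i w - η (t + 1) * powForm L (i + 1) w := fun i =>
      (powForm_sub_smul_le hL hm0 hm (hη (t + 1)) (hηm (t + 1) (by omega)) i w).trans (by
        nlinarith [powForm_nonneg hL i w])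
    have h2 : powForm L (n + 1) (w - η (t + 1) • (L w + lam • w)) ≤ powForm L (n + 1) w :=
      (h1 _).trans (by linarith [mul_nonneg (hη (t + 1)) (powForm_nonneg hL (n + 1 + 1) w)])
    have h3 := mul_le_mul_of_nonneg_left h2 (add_nonneg hs0 (hη (t + 1)))
    linarith [h1 n]

variable [CompleteSpace H]

theorem isUnit_add_smul_one (hL : L.IsPositive) (hlam : 0 < lam) :
    IsUnit (L + lam • (1 : H →L[ℝ] H)) := by
  refine ContinuousLinearMap.isUnit_of_forall_le_norm_inner_map _ (c := ⟨lam, hlam.le⟩) hlam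
    fun x => ?_
  have h1 : inner ℝ ((L + lam • (1 : H →L[ℝ] H)) x) x = inner ℝ (L x) x + lam * ‖x‖ ^ 2 := by
    simp [inner_add_left, inner_smul_left]
  have h2 := hL.inner_nonneg_left x
  rw [h1, Real.norm_eq_abs, abs_of_nonneg (by positivity)]
  change ‖x‖ ^ 2 * lam ≤ _
  linarith

/-- On the spectrum this reads `σ Π(σ)² ≤ σ / (s σ + 1)`. With `x = (s L + 1) y` both sides become
combinations of forms of `P y` and `y`, and the claim is the Lyapunov bound of order `1` plus `s`
times that of order `2`. -/
theorem inner_map_propagator_le (hL : L.IsPositive) (hm0 : 0 < m)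
    (hm : ∀ u, inner ℝ (L u) u ≤ m * ‖u‖ ^ 2) (hη : ∀ j, 0 ≤ η j) (hlam : 0 ≤ lam)
    (hηm : ∀ j, 1 ≤ j → η j * (m + 2 * lam) ≤ 1) {k t : ℕ} (hkt : k ≤ t) {s : ℝ} (hs0 : 0 < s)
    (hs : s = ∑ j ∈ Finset.Ioc k t, η j) (x : H) :
    inner ℝ (L (propagator L lam η k t x)) (propagator L lam η k t x) ≤
      s⁻¹ * inner ℝ x ((L * Ring.inverse (L + s⁻¹ • (1 : H →L[ℝ] H))) x) := by
  set P := propagator L lam η k t with hP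
  set D := Ring.inverse (L + s⁻¹ • (1 : H →L[ℝ] H)) with hD
  have hu := isUnit_add_smul_one hL (inv_pos.2 hs0)
  have hx : x = L (D x) + s⁻¹ • D x := by
    have h := DFunLike.congr_fun (Ring.mul_inverse_cancel _ hu) x
    simpa using h.symm
  set y := s⁻¹ • D x with hy
  have hDx : D x = s • y := by rw [hy, smul_smul, mul_inv_cancel₀ hs0.ne', one_smul]
  clear_value y
  have hx' : x = s • L y + y := by rw [← map_smul, ← hDx]; exact hx
  have hPx : P x = s • L (P y) + P y := by
    rw [hx', map_add, map_smul, hP, propagator_map]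
  have h1 := sum_mul_powForm_propagator_le hL hm0 hm hη hlam hηm 1 hkt y
  have h2 := sum_mul_powForm_propagator_le hL hm0 hm hη hlam hηm 2 hkt y
  rw [← hs, ← hP] at h1 h2
  have e1 : inner ℝ (L (P x)) (P x) = s ^ 2 * powForm L 3 (P y) + 2 * s * powForm L 2 (P y)
      + powForm L 1 (P y) := by
    -- The vector `(s L + 1) (P y)` is a gradient step of size `-s` without regularization, so the
    -- general expansion applies.
    have e := powForm_sub_smul hL 1 (-s) 0 (P y)
    rw [powForm_one] at e
    rw [hPx]
    have : P y - -s • (L (P y) + (0 : ℝ) • P y) = s • L (P y) + P y := by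
      rw [zero_smul, add_zero, neg_smul, sub_neg_eq_add, add_comm]
    rw [this] at e
    rw [e]
    ring
  have e2 : s⁻¹ * inner ℝ x ((L * D) x) = s * powForm L 2 y + powForm L 1 y := by
    rw [mul_apply_eq_comp, hDx, hx', powForm_add_two hL, powForm_zero, powForm_one,
      map_smul, inner_smul_right, ← mul_assoc, inv_mul_cancel₀ hs0.ne', one_mul, inner_add_left,
      inner_smul_left, real_inner_self_eq_norm_sq, RCLike.conj_to_real, real_inner_comm]
  rw [e1, e2]
  nlinarith [mul_le_mul_of_nonneg_left h2 hs0.le]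

end Propagator

/-! ### Spectral bounds for fractional powers -/

section SpectralBound

variable {H : Type*} [NormedAddCommGroup H] [InnerProductSpace ℝ H]
  {L : H →L[ℝ] H}

theorem mem_eigenKer {σ : ℝ} {u : H} : u ∈ eigenKer L σ ↔ L u = σ • u := by
  rw [LinearMap.mem_ker]
  simp [sub_eq_zero]

theorem orthogonalFamily_eigenKer (hL : L.IsPositive) :
    OrthogonalFamily ℝ (fun σ : ℝ => eigenKer L σ) fun σ => (eigenKer L σ).subtypeₗᵢ := by
  intro σ τ hστ u w
  have hu := mem_eigenKer.1 u.2
  have hw := mem_eigenKer.1 w.2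
  have h := hL.inner_left_eq_inner_right (u : H) (w : H)
  rw [hu, hw, inner_smul_left, inner_smul_right, RCLike.conj_to_real] at h
  have h' : (σ - τ) * inner ℝ (u : H) (w : H) = 0 := by linarith
  exact (mul_eq_zero.1 h').resolve_left (sub_ne_zero.2 hστ)

theorem eigenvalue_nonneg (hL : L.IsPositive) {σ : ℝ} {u : H} (hu : u ≠ 0) (h : L u = σ • u) :
    0 ≤ σ := by
  have h1 := hL.inner_nonneg_left u
  rw [h, inner_smul_left, real_inner_self_eq_norm_sq, RCLike.conj_to_real] at h1
  exact nonneg_of_mul_nonneg_left h1 (by positivity)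

theorem eigenvalue_le {m : ℝ} (hm : ∀ u, inner ℝ (L u) u ≤ m * ‖u‖ ^ 2) {σ : ℝ} {u : H}
    (hu : u ≠ 0) (h : L u = σ • u) : σ ≤ m := by
  have h1 := hm u
  rw [h, inner_smul_left, real_inner_self_eq_norm_sq, RCLike.conj_to_real] at h1
  exact le_of_mul_le_mul_right h1 (by positivity)

variable [CompleteSpace H]

theorem norm_sum_smul_starProjection_sq (hL : L.IsPositive) (F : Finset ℝ) (a : ℝ → ℝ) (g : H) :
    ‖∑ σ ∈ F, a σ • (eigenKer L σ).starProjection g‖ ^ 2 =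
      ∑ σ ∈ F, a σ ^ 2 * ‖(eigenKer L σ).starProjection g‖ ^ 2 := by
  have h := (orthogonalFamily_eigenKer hL).norm_sum
    (fun σ => a σ • (eigenKer L σ).orthogonalProjectionOnto g) F
  simp only [map_smul, norm_smul, mul_pow, Real.norm_eq_abs, sq_abs] at h
  exact h

theorem sum_norm_starProjection_sq_le (hL : L.IsPositive) (F : Finset ℝ) (g : H) :
    ∑ σ ∈ F, ‖(eigenKer L σ).starProjection g‖ ^ 2 ≤ ‖g‖ ^ 2 := by
  have h1 := norm_sum_smul_starProjection_sq hL F (fun _ => 1) g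
  simp only [one_smul, one_pow, one_mul] at h1
  have h2 : inner ℝ g (∑ σ ∈ F, (eigenKer L σ).starProjection g) =
      ∑ σ ∈ F, ‖(eigenKer L σ).starProjection g‖ ^ 2 := by
    rw [inner_sum]
    refine Finset.sum_congr rfl fun σ _ => ?_
    have h := Submodule.inner_starProjection_left_eq_right (eigenKer L σ) g
      ((eigenKer L σ).starProjection g)
    rw [Submodule.starProjection_eq_self_iff.2 (Submodule.starProjection_apply_mem _ _)] at h
    rw [← h, real_inner_self_eq_norm_sq]
  have h3 := real_inner_le_norm g (∑ σ ∈ F, (eigenKer L σ).starProjection g)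
  rw [h2, ← h1] at h3
  rw [← h1]
  nlinarith [norm_nonneg g, norm_nonneg (∑ σ ∈ F, (eigenKer L σ).starProjection g),
    sq_nonneg (‖g‖ - ‖∑ σ ∈ F, (eigenKer L σ).starProjection g‖)]

/-- `Y` acts as a scalar on each eigenspace, so Pythagoras and Bessel bound the finite partial sums,
and the bound passes to the limit. Completeness of the eigenvectors is never needed; a non-summable
family has sum `0` by convention. -/
theorem norm_map_operatorPow_le (hL : L.IsPositive) (r : ℝ) (Y : H →L[ℝ] H) (y : ℝ → ℝ)
    (hY : ∀ σ u, L u = σ • u → Y u = y σ • u) {C : ℝ} (hC : 0 ≤ C)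
    (hyC : ∀ σ u, u ≠ 0 → L u = σ • u → |y σ * σ ^ r| ≤ C) (g : H) :
    ‖Y (operatorPow L r g)‖ ≤ C * ‖g‖ := by
  rw [operatorPow]
  by_cases hs : Summable fun σ : ℝ => σ ^ r • (eigenKer L σ).starProjection g
  · refine le_of_tendsto ((Y.continuous.tendsto _).comp hs.hasSum).norm
      (Filter.Eventually.of_forall fun F => ?_)
    have h1 : Y (∑ σ ∈ F, σ ^ r • (eigenKer L σ).starProjection g) =
        ∑ σ ∈ F, (y σ * σ ^ r) • (eigenKer L σ).starProjection g := by
      rw [map_sum]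
      refine Finset.sum_congr rfl fun σ _ => ?_
      rw [map_smul, hY σ _ (mem_eigenKer.1 (Submodule.starProjection_apply_mem _ g)), smul_smul,
        mul_comm]
    refine abs_le_of_sq_le_sq' ?_ (by positivity) |>.2
    change ‖Y (∑ σ ∈ F, σ ^ r • (eigenKer L σ).starProjection g)‖ ^ 2 ≤ _
    rw [h1, norm_sum_smul_starProjection_sq hL F (fun σ => y σ * σ ^ r), mul_pow]
    refine le_trans ?_ (mul_le_mul_of_nonneg_left (sum_norm_starProjection_sq_le hL F g)
      (sq_nonneg C))
    rw [Finset.mul_sum]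
    refine Finset.sum_le_sum fun σ _ => ?_
    by_cases h0 : (eigenKer L σ).starProjection g = 0
    · simp [h0]
    · refine mul_le_mul_of_nonneg_right ?_ (sq_nonneg _)
      rw [← sq_abs]
      exact pow_le_pow_left₀ (abs_nonneg _)
        (hyC σ _ h0 (mem_eigenKer.1 (Submodule.starProjection_apply_mem _ g))) 2
  · rw [tsum_eq_zero_of_not_summable hs, map_zero, norm_zero]
    positivity

theorem norm_operatorPow_le (hL : L.IsPositive) {m : ℝ} (hm0 : 0 ≤ m)
    (hm : ∀ u, inner ℝ (L u) u ≤ m * ‖u‖ ^ 2) {r : ℝ} (hr : 0 ≤ r) (g : H) :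
    ‖operatorPow L r g‖ ≤ m ^ r * ‖g‖ := by
  refine norm_map_operatorPow_le hL r 1 (fun _ => 1) (by simp) (by positivity) ?_ g
  intro σ u hu h
  have h0 := eigenvalue_nonneg hL hu h
  rw [one_mul, abs_of_nonneg (by positivity)]
  exact Real.rpow_le_rpow h0 (eigenvalue_le hm hu h) hr

/-- The approximation error `‖λ (L + λ)⁻¹ L^r g‖ ≤ λ^r ‖g‖`, `0 ≤ r ≤ 1`. -/
theorem norm_smul_inverse_operatorPow_le (hL : L.IsPositive) {lam : ℝ} (hlam : 0 < lam) {r : ℝ}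
    (hr0 : 0 ≤ r) (hr1 : r ≤ 1) (g : H) :
    ‖lam • Ring.inverse (L + lam • (1 : H →L[ℝ] H)) (operatorPow L r g)‖ ≤ lam ^ r * ‖g‖ := by
  have hu := isUnit_add_smul_one hL hlam
  set D := Ring.inverse (L + lam • (1 : H →L[ℝ] H)) with hD
  have key : ∀ σ u, L u = σ • u → (lam • D) u = (lam / (σ + lam)) • u := by
    intro σ u h
    by_cases hu0 : u = 0
    · simp [hu0]
    have h0 := eigenvalue_nonneg hL hu0 h
    have h1 : D ((L + lam • (1 : H →L[ℝ] H)) u) = u := by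
      have h := DFunLike.congr_fun (Ring.inverse_mul_cancel _ hu) u
      simpa using h
    have h2 : (L + lam • (1 : H →L[ℝ] H)) u = (σ + lam) • u := by
      simp [h, add_smul]
    rw [h2, map_smul] at h1
    have h3 : (σ + lam) ≠ 0 := by positivity
    rw [smul_apply, div_eq_mul_inv, mul_smul]
    congr 1
    rw [eq_inv_smul_iff₀ h3, h1]
  refine norm_map_operatorPow_le hL r (lam • D) (fun σ => lam / (σ + lam)) key (by positivity) ?_ g
  intro σ u hu0 h
  have h0 := eigenvalue_nonneg hL hu0 h
  rw [abs_of_nonneg (by positivity), div_mul_eq_mul_div, div_le_iff₀ (by positivity)]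
  -- Weighted AM-GM gives `σ^r λ^(1-r) ≤ r σ + (1-r) λ ≤ σ + λ`; multiplying by `λ^r` yields the
  -- claim.
  have hw := Real.geom_mean_le_arith_mean2_weighted (w₁ := r) (w₂ := 1 - r) hr0 (by linarith) h0
    hlam.le (by ring)
  have h4 : lam ^ r * lam ^ (1 - r) = lam := by
    rw [← Real.rpow_add hlam]; simp
  calc lam * σ ^ r = lam ^ r * (σ ^ r * lam ^ (1 - r)) := by
        nth_rewrite 1 [← h4]; ring
    _ ≤ lam ^ r * (r * σ + (1 - r) * lam) := by gcongr
    _ ≤ lam ^ r * (σ + lam) := by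
        refine mul_le_mul_of_nonneg_left ?_ (by positivity)
        nlinarith [mul_le_mul_of_nonneg_right hr1 h0, mul_nonneg hr0 hlam.le]

end SpectralBound

/-! ### Traces -/

section Trace

variable {H : Type*} [NormedAddCommGroup H] [InnerProductSpace ℝ H]

/-- Orthonormal vectors are `√2` apart, so balls of radius `1/2` around them are disjoint.
Countability is what allows the sum over a Hilbert basis to be exchanged with an integral. -/
theorem _root_.Orthonormal.countable [TopologicalSpace.SeparableSpace H] {ι : Type*} {e : ι → H}
    (he : Orthonormal ℝ e) : Countable ι := by
  rw [← Set.countable_univ_iff]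
  refine Set.PairwiseDisjoint.countable_of_isOpen (s := fun i => Metric.ball (e i) (1 / 2)) ?_
    (fun _ _ => Metric.isOpen_ball) (fun i _ => ⟨e i, Metric.mem_ball_self (by norm_num)⟩)
  intro i _ j _ hij
  refine Metric.ball_disjoint_ball ?_
  have h : ‖e i - e j‖ ^ 2 = 2 := by
    rw [norm_sub_sq_real, he.1 i, he.1 j, he.2 hij]
    norm_num
  rw [dist_eq_norm]
  nlinarith [norm_nonneg (e i - e j)]

theorem ofReal_norm_sq_eq_tsum {ι : Type*} (e : HilbertBasis ι ℝ H) (u : H) :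
    ENNReal.ofReal (‖u‖ ^ 2) = ∑' i, ENNReal.ofReal (inner ℝ (e i) u ^ 2) := by
  have h := e.hasSum_inner_mul_inner u u
  simp only [real_inner_self_eq_norm_sq, real_inner_comm u, ← pow_two] at h
  simp_rw [real_inner_comm u]
  rw [← h.tsum_eq, ENNReal.ofReal_tsum_of_nonneg (fun i => sq_nonneg _) h.summable]

variable [CompleteSpace H] {V : Type*} [MeasurableSpace V] {μ : Measure V}

theorem operatorTrace_smul {a : ℝ} (ha : 0 ≤ a) (A : H →L[ℝ] H) :
    operatorTrace (a • A) = ENNReal.ofReal a * operatorTrace A := by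
  rw [operatorTrace, operatorTrace, ← ENNReal.tsum_mul_left]
  refine tsum_congr fun i => ?_
  rw [smul_apply, inner_smul_right, ENNReal.ofReal_mul ha]

variable [TopologicalSpace.SeparableSpace H] {L : H →L[ℝ] H} {Φ : V → H}

/-- Parseval and Tonelli turn a domination of quadratic forms into one of traces, basis vector by
basis vector. -/
theorem lintegral_norm_sq_le_operatorTrace (hΦ : StronglyMeasurable Φ) (P A : H →L[ℝ] H)
    (hP : ∀ x, ∫⁻ v, ENNReal.ofReal (inner ℝ x (P (Φ v)) ^ 2) ∂μ ≤
      ENNReal.ofReal (inner ℝ x (A x))) :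
    ∫⁻ v, ENNReal.ofReal (‖P (Φ v)‖ ^ 2) ∂μ ≤ operatorTrace A := by
  set e := (exists_hilbertBasis ℝ H).choose_spec.choose with he
  have : Countable (exists_hilbertBasis ℝ H).choose := e.orthonormal.countable
  simp_rw [ofReal_norm_sq_eq_tsum e]
  rw [lintegral_tsum, operatorTrace]
  · exact ENNReal.tsum_le_tsum fun i => hP (e i)
  · intro i
    refine Measurable.aemeasurable (ENNReal.measurable_ofReal.comp (Measurable.pow_const ?_ 2))
    exact ((continuous_const.inner P.continuous).comp_stronglyMeasurable hΦ).measurable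

/-- Moving the propagator to `x` gives second moment `⟪L Π x, Π x⟫`, which is at most `s⁻¹ ⟪x, L (L
+ s⁻¹)⁻¹ x⟫`. Its trace is `s⁻¹` times the effective dimension at `s⁻¹`, hence the exponent `γ - 1`.
-/
theorem lintegral_norm_propagator_sq_le (hΦ : StronglyMeasurable Φ)
    (hΦL : ∀ x, ∫⁻ v, ENNReal.ofReal (inner ℝ x (Φ v) ^ 2) ∂μ = ENNReal.ofReal (inner ℝ (L x) x))
    (hL : L.IsPositive) {m : ℝ} (hm0 : 0 < m) (hm : ∀ u, inner ℝ (L u) u ≤ m * ‖u‖ ^ 2)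
    {η : ℕ → ℝ} {lam : ℝ} (hη : ∀ j, 0 ≤ η j) (hlam : 0 ≤ lam)
    (hηm : ∀ j, 1 ≤ j → η j * (m + 2 * lam) ≤ 1) {k t : ℕ} (hkt : k ≤ t) {s : ℝ} (hs0 : 0 < s)
    (hs : s = ∑ j ∈ Finset.Ioc k t, η j) {γ c : ℝ}
    (hcap : effectiveDim L s⁻¹ ≤ ENNReal.ofReal (c * s⁻¹ ^ (-γ))) :
    ∫⁻ v, ENNReal.ofReal (‖propagator L lam η k t (Φ v)‖ ^ 2) ∂μ ≤
      ENNReal.ofReal (c * s ^ (γ - 1)) := by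
  refine (lintegral_norm_sq_le_operatorTrace hΦ _
    (s⁻¹ • (L * Ring.inverse (L + s⁻¹ • (1 : H →L[ℝ] H)))) fun x => ?_).trans ?_
  · simp_rw [← inner_propagator_left hL]
    rw [hΦL, smul_apply, inner_smul_right]
    exact ENNReal.ofReal_le_ofReal (inner_map_propagator_le hL hm0 hm hη hlam hηm hkt hs0 hs x)
  · rw [operatorTrace_smul (by positivity)]
    refine (mul_le_mul_right hcap _).trans (le_of_eq ?_)
    rw [← ENNReal.ofReal_mul (by positivity)]
    congr 1
    rw [Real.rpow_sub hs0, Real.rpow_one, Real.inv_rpow hs0.le, Real.rpow_neg hs0.le, inv_inv]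
    ring

end Trace

/-! ### Rank-one random operators -/

section FeatureOperator

variable {H : Type*} [NormedAddCommGroup H] [InnerProductSpace ℝ H]
  {V : Type*} [MeasurableSpace V] {μ : Measure V}
  {Φ : V → H} {κ : ℝ} {L : H →L[ℝ] H}

theorem isPositive_of_inner_eq
    (hL : ∀ u w, inner ℝ u (L w) = ∫ v, inner ℝ u (Φ v) * inner ℝ (Φ v) w ∂μ) :
    L.IsPositive := by
  rw [ContinuousLinearMap.isPositive_iff]
  refine ⟨fun u w => ?_, fun u => ?_⟩
  · change inner ℝ (L u) w = inner ℝ u (L w)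
    rw [real_inner_comm, hL, hL]
    refine integral_congr_ae (Filter.Eventually.of_forall fun v => ?_)
    simp only [real_inner_comm u, real_inner_comm w]
    ring
  · rw [real_inner_comm, hL]
    refine integral_nonneg fun v => ?_
    simp only [Pi.zero_apply, real_inner_comm u]
    exact mul_self_nonneg _

variable [IsProbabilityMeasure μ]

theorem integrable_inner_mul_inner (hΦ : StronglyMeasurable Φ) (hΦκ : ∀ v, ‖Φ v‖ ≤ κ) (u w : H) :
    Integrable (fun v => inner ℝ u (Φ v) * inner ℝ (Φ v) w) μ := by
  have h1 : StronglyMeasurable fun v => inner ℝ u (Φ v) * inner ℝ (Φ v) w :=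
    (stronglyMeasurable_const.inner hΦ).mul (hΦ.inner stronglyMeasurable_const)
  refine Integrable.of_bound h1.aestronglyMeasurable (‖u‖ * κ * (κ * ‖w‖))
    (Filter.Eventually.of_forall fun v => ?_)
  have hκ : 0 ≤ κ := (norm_nonneg _).trans (hΦκ v)
  rw [norm_mul]
  refine mul_le_mul ((norm_inner_le_norm _ _).trans ?_) ((norm_inner_le_norm _ _).trans ?_)
    (norm_nonneg _) (by positivity)
  · exact mul_le_mul_of_nonneg_left (hΦκ v) (norm_nonneg _)
  · exact mul_le_mul_of_nonneg_right (hΦκ v) (norm_nonneg _)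

theorem lintegral_inner_sq_eq (hΦ : StronglyMeasurable Φ) (hΦκ : ∀ v, ‖Φ v‖ ≤ κ)
    (hL : ∀ u w, inner ℝ u (L w) = ∫ v, inner ℝ u (Φ v) * inner ℝ (Φ v) w ∂μ) (x : H) :
    ∫⁻ v, ENNReal.ofReal (inner ℝ x (Φ v) ^ 2) ∂μ = ENNReal.ofReal (inner ℝ (L x) x) := by
  have h := integrable_inner_mul_inner (μ := μ) hΦ hΦκ x x
  rw [real_inner_comm, hL]
  simp only [real_inner_comm x, ← pow_two] at h ⊢
  exact (ofReal_integral_eq_lintegral_ofReal h (Filter.Eventually.of_forall fun v =>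
    sq_nonneg _)).symm

theorem inner_map_self_le (hΦ : StronglyMeasurable Φ) (hΦκ : ∀ v, ‖Φ v‖ ≤ κ)
    (hL : ∀ u w, inner ℝ u (L w) = ∫ v, inner ℝ u (Φ v) * inner ℝ (Φ v) w ∂μ) (x : H) :
    inner ℝ (L x) x ≤ κ ^ 2 * ‖x‖ ^ 2 := by
  rw [real_inner_comm, hL]
  refine (integral_mono (integrable_inner_mul_inner hΦ hΦκ x x)
    (integrable_const (κ ^ 2 * ‖x‖ ^ 2)) fun v => ?_).trans (by simp)
  simp only [real_inner_comm x, ← pow_two]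
  rw [← mul_pow, ← sq_abs]
  refine pow_le_pow_left₀ (abs_nonneg _) ?_ 2
  have := norm_inner_le_norm (𝕜 := ℝ) x (Φ v)
  rw [Real.norm_eq_abs] at this
  refine this.trans ?_
  rw [mul_comm]
  exact mul_le_mul_of_nonneg_right (hΦκ v) (norm_nonneg _)

variable [CompleteSpace H]

/-- Bias-variance inequality for `a - η g Ψ`, where `q` is the mean of `g Ψ`. -/
theorem lintegral_norm_map_sub_sq_le (hΦ : StronglyMeasurable Φ) (hΦκ : ∀ v, ‖Φ v‖ ≤ κ)
    {g : V → ℝ} (hg : MemLp g 2 μ) {q : H}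
    (hq : ∀ w, ∫ v, g v * inner ℝ (Φ v) w ∂μ = inner ℝ q w) (B : H →L[ℝ] H) (a : H) (η : ℝ) :
    ∫⁻ v, ENNReal.ofReal (‖B (a - η • g v • Φ v)‖ ^ 2) ∂μ ≤
      ENNReal.ofReal (‖B (a - η • q)‖ ^ 2)
        + ∫⁻ v, ENNReal.ofReal (η ^ 2 * (g v ^ 2 * ‖B (Φ v)‖ ^ 2)) ∂μ := by
  have hBm : StronglyMeasurable fun v => B (Φ v) := B.continuous.comp_stronglyMeasurable hΦ
  have hBb : ∀ v, ‖B (Φ v)‖ ≤ ‖B‖ * κ := fun v =>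
    (B.le_opNorm _).trans (mul_le_mul_of_nonneg_left (hΦκ v) (norm_nonneg _))
  have hgi : Integrable g μ := hg.integrable (by norm_num)
  have hi1 : Integrable (fun v => g v * inner ℝ (B a) (B (Φ v))) μ := by
    refine hgi.mul_bdd (c := ‖B a‖ * (‖B‖ * κ))
      (stronglyMeasurable_const.inner hBm).aestronglyMeasurable
      (Filter.Eventually.of_forall fun v => ?_)
    exact (norm_inner_le_norm _ _).trans (mul_le_mul_of_nonneg_left (hBb v) (norm_nonneg _))
  have hi2 : Integrable (fun v => g v ^ 2 * ‖B (Φ v)‖ ^ 2) μ := by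
    refine hg.integrable_sq.mul_bdd (c := (‖B‖ * κ) ^ 2)
      (hBm.norm.pow 2).aestronglyMeasurable (Filter.Eventually.of_forall fun v => ?_)
    rw [Real.norm_eq_abs, abs_of_nonneg (sq_nonneg _)]
    exact pow_le_pow_left₀ (norm_nonneg _) (hBb v) 2
  have hpt : ∀ v, ‖B (a - η • g v • Φ v)‖ ^ 2 =
      ‖B a‖ ^ 2 - 2 * η * (g v * inner ℝ (B a) (B (Φ v)))
        + η ^ 2 * (g v ^ 2 * ‖B (Φ v)‖ ^ 2) := by
    intro v
    rw [map_sub, norm_sub_sq_real, map_smul, map_smul, inner_smul_right, inner_smul_right, norm_smul,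
      norm_smul, mul_pow, mul_pow, Real.norm_eq_abs, Real.norm_eq_abs, sq_abs, sq_abs]
    ring
  have hmean : ∫ v, g v * inner ℝ (B a) (B (Φ v)) ∂μ = inner ℝ (B a) (B q) := by
    -- The mean `q` is known only through inner products, so `B` is transferred to the test vector
    -- by its adjoint.
    have h := hq (ContinuousLinearMap.adjoint B (B a))
    simp only [ContinuousLinearMap.adjoint_inner_right] at h
    rw [real_inner_comm, ← h]
    simp only [real_inner_comm (B a)]
  have hI : Integrable (fun v => ‖B a‖ ^ 2 - 2 * η * (g v * inner ℝ (B a) (B (Φ v)))) μ :=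
    (integrable_const _).sub (hi1.const_mul _)
  have hint : Integrable (fun v => ‖B (a - η • g v • Φ v)‖ ^ 2) μ := by
    simp_rw [hpt]
    exact hI.add (hi2.const_mul _)
  rw [← ofReal_integral_eq_lintegral_ofReal hint (Filter.Eventually.of_forall fun v => sq_nonneg _),
    ← ofReal_integral_eq_lintegral_ofReal (hi2.const_mul _)
      (Filter.Eventually.of_forall fun v => mul_nonneg (sq_nonneg _)
        (mul_nonneg (sq_nonneg _) (sq_nonneg _))),
    ← ENNReal.ofReal_add (sq_nonneg _) (integral_nonneg fun v => mul_nonneg (sq_nonneg _)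
        (mul_nonneg (sq_nonneg _) (sq_nonneg _)))]
  refine ENNReal.ofReal_le_ofReal ?_
  simp_rw [hpt]
  rw [integral_add hI (hi2.const_mul _), integral_sub (integrable_const _) (hi1.const_mul _),
    integral_const_mul, hmean, map_sub, norm_sub_sq_real, map_smul, inner_smul_right]
  simp only [integral_const, probReal_univ, one_smul]
  -- The variance is bounded by the second moment; what is lost is `‖η B q‖²`.
  nlinarith [sq_nonneg ‖η • B q‖]

end FeatureOperator

/-! ### Functions as elements of `L²` -/

section ToL2

variable {X : Type*} [MeasurableSpace X] {ρX : Measure X}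

open Classical in
/-- The class of `f` in `L²(ρX)`, and `0` if `f` is not square-integrable. -/
def toL2 (ρX : Measure X) (f : X → ℝ) : Lp ℝ 2 ρX :=
  if h : MemLp f 2 ρX then h.toLp f else 0

theorem coeFn_toL2 {f : X → ℝ} (h : MemLp f 2 ρX) : toL2 ρX f =ᵐ[ρX] f := by
  rw [toL2, dif_pos h]
  exact h.coeFn_toLp

theorem inner_eq_integral (u w : Lp ℝ 2 ρX) : inner ℝ u w = ∫ x, u x * w x ∂ρX := by
  rw [L2.inner_def]
  simp only [RCLike.inner_apply, conj_trivial, mul_comm]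

theorem norm_sq_eq_integral (u : Lp ℝ 2 ρX) : ‖u‖ ^ 2 = ∫ x, u x ^ 2 ∂ρX := by
  rw [← real_inner_self_eq_norm_sq, inner_eq_integral]
  simp only [pow_two]

theorem inner_toL2_left {f : X → ℝ} (h : MemLp f 2 ρX) (w : Lp ℝ 2 ρX) :
    inner ℝ (toL2 ρX f) w = ∫ x, f x * w x ∂ρX := by
  rw [inner_eq_integral]
  refine integral_congr_ae ?_
  filter_upwards [coeFn_toL2 h] with x hx
  rw [hx]

theorem norm_toL2_sub_sq {f : X → ℝ} (h : MemLp f 2 ρX) (w : Lp ℝ 2 ρX) :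
    ‖toL2 ρX f - w‖ ^ 2 = ∫ x, (f x - w x) ^ 2 ∂ρX := by
  rw [norm_sq_eq_integral]
  refine integral_congr_ae ?_
  filter_upwards [coeFn_toL2 h, Lp.coeFn_sub (toL2 ρX f) w] with x hx hx'
  rw [hx', Pi.sub_apply, hx]

theorem norm_toL2_le [IsProbabilityMeasure ρX] {f : X → ℝ} (h : MemLp f 2 ρX) {C : ℝ} (hC : 0 ≤ C)
    (hf : ∀ x, |f x| ≤ C) : ‖toL2 ρX f‖ ≤ C := by
  have h1 : ∀ᵐ x ∂ρX, ‖toL2 ρX f x‖ ≤ C := by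
    filter_upwards [coeFn_toL2 h] with x hx
    rw [hx]
    exact hf x
  refine (Lp.norm_le_of_ae_bound hC h1).trans (le_of_eq ?_)
  simp [measureUnivNNReal]

/-- Every open set is a countable union of balls with centres in a countable dense set and rational
radii, so measurable distances suffice. -/
theorem stronglyMeasurable_of_measurable_dist {Ω E : Type*} [MeasurableSpace Ω] [MetricSpace E]
    [SecondCountableTopology E] {F : Ω → E} (h : ∀ g, Measurable fun ω => dist (F ω) g) :
    StronglyMeasurable F := by
  borelize E
  refine Measurable.stronglyMeasurable (measurable_of_isOpen fun U hU => ?_)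
  obtain ⟨D, hDc, hDd⟩ := TopologicalSpace.exists_countable_dense E
  have hU' : F ⁻¹' U = ⋃ p ∈ {p : E × ℚ | p.1 ∈ D ∧ Metric.ball p.1 p.2 ⊆ U},
      {ω | dist (F ω) p.1 < p.2} := by
    ext ω
    simp only [Set.mem_preimage, Set.mem_iUnion, Set.mem_ofPred_eq, exists_prop]
    constructor
    · intro hω
      obtain ⟨r, hr, hrU⟩ := Metric.isOpen_iff.1 hU _ hω
      obtain ⟨q, hq0, hq⟩ := exists_rat_btwn (half_pos hr)
      obtain ⟨d, hd, hdD⟩ := Metric.dense_iff.1 hDd (F ω) q hq0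
      refine ⟨(d, q), ⟨hdD, fun y hy => hrU ?_⟩, ?_⟩
      · rw [Metric.mem_ball] at hy hd ⊢
        simp only at hy
        linarith [dist_triangle y d (F ω)]
      · rw [dist_comm]; exact hd
    · rintro ⟨p, ⟨-, hp⟩, hω⟩
      exact hp hω
  rw [hU']
  refine MeasurableSet.biUnion ?_ fun p _ => measurableSet_lt (h p.1) measurable_const
  exact (hDc.prod (Set.countable_univ (α := ℚ))).mono fun p hp =>
    Set.mem_prod.2 ⟨hp.1, Set.mem_univ _⟩

/-- The distance to a fixed class is the root of a parameter integral, measurable by Fubini. This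
makes features and iterates genuine random elements of `L²`. -/
theorem stronglyMeasurable_toL2 [SFinite ρX] [SecondCountableTopology (Lp ℝ 2 ρX)] {Ω : Type*}
    [MeasurableSpace Ω] {F : Ω → X → ℝ} (hF : Measurable (Function.uncurry F))
    (hF2 : ∀ ω, MemLp (F ω) 2 ρX) : StronglyMeasurable fun ω => toL2 ρX (F ω) := by
  refine stronglyMeasurable_of_measurable_dist fun g => ?_
  have h : ∀ ω, dist (toL2 ρX (F ω)) g = √(∫ x, (F ω x - g x) ^ 2 ∂ρX) := fun ω => by
    rw [← norm_toL2_sub_sq (hF2 ω), Real.sqrt_sq (norm_nonneg _), dist_eq_norm]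
  simp_rw [h]
  have h1 : StronglyMeasurable (Function.uncurry fun (ω : Ω) (x : X) => (F ω x - g x) ^ 2) :=
    ((hF.sub ((Lp.stronglyMeasurable g).measurable.comp measurable_snd)).pow_const 2
      ).stronglyMeasurable
  exact h1.integral_prod_right.measurable.sqrt

end ToL2

/-! ### The integral operator in terms of the features -/

section FeatureMap

variable {X V : Type*} [MeasurableSpace X] [MeasurableSpace V]

theorem measurable_feature_left {φ : V → X → ℝ} (hφ : Measurable (Function.uncurry φ)) (v : V) :
    Measurable (φ v) := hφ.comp measurable_prodMk_left

theorem memLp_of_forall_abs_le {ρX : Measure X} [IsFiniteMeasure ρX] {f : X → ℝ} (hf : Measurable f)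
    {C : ℝ} (hC : ∀ x, |f x| ≤ C) (p : ℝ≥0∞) : MemLp f p ρX :=
  MemLp.of_bound hf.aestronglyMeasurable C (Filter.Eventually.of_forall hC)

variable {ρX : Measure X} [IsProbabilityMeasure ρX] {μ : Measure V} [IsProbabilityMeasure μ]
  {φ : V → X → ℝ} {κ : ℝ} {K : X → X → ℝ}

/-- By Fubini, `L_K` is the second moment operator of the random vector `φ_v`. The kernel formula is
required only almost everywhere so that truncated features can be used with the original kernel. -/
theorem inner_integralOp (hK : IsBoundedKernel K) (hφ : Measurable (Function.uncurry φ))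
    (hφκ : ∀ v x, |φ v x| ≤ κ)
    (hKφ : ∀ᵐ p ∂ρX.prod ρX, K p.1 p.2 = ∫ v, φ v p.1 * φ v p.2 ∂μ) (u w : Lp ℝ 2 ρX) :
    inner ℝ u (integralOp ρX K w) =
      ∫ v, inner ℝ u (toL2 ρX (φ v)) * inner ℝ (toL2 ρX (φ v)) w ∂μ := by
  have hφ2 : ∀ v, MemLp (φ v) 2 ρX := fun v =>
    memLp_of_forall_abs_le (measurable_feature_left hφ v) (hφκ v) 2
  have hui : Integrable u ρX := (Lp.memLp u).integrable (by norm_num)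
  have hwi : Integrable w ρX := (Lp.memLp w).integrable (by norm_num)
  have hmu := (Lp.stronglyMeasurable u).measurable
  have hmw := (Lp.stronglyMeasurable w).measurable
  have huw : Integrable (fun p : X × X => u p.1 * w p.2) (ρX.prod ρX) := hui.mul_prod hwi
  set h : X × X → V → ℝ := fun p v => (u p.1 * φ v p.1) * (w p.2 * φ v p.2) with hh
  have hm1 : Measurable fun q : (X × X) × V => φ q.2 q.1.1 :=
    hφ.comp (measurable_snd.prodMk (measurable_fst.comp measurable_fst))
  have hm2 : Measurable fun q : (X × X) × V => φ q.2 q.1.2 :=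
    hφ.comp (measurable_snd.prodMk (measurable_snd.comp measurable_fst))
  have hint : Integrable (Function.uncurry h) ((ρX.prod ρX).prod μ) := by
    have h1 : Integrable (fun q : (X × X) × V => (u q.1.1 * w q.1.2) * (φ q.2 q.1.1 * φ q.2 q.1.2))
        ((ρX.prod ρX).prod μ) := by
      refine (huw.comp_fst μ).mul_bdd (c := κ * κ) (hm1.mul hm2).aestronglyMeasurable
        (Filter.Eventually.of_forall fun q => ?_)
      rw [norm_mul]
      exact mul_le_mul (hφκ _ _) (hφκ _ _) (norm_nonneg _) ((abs_nonneg _).trans (hφκ q.2 q.1.1))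
    refine h1.congr (Filter.Eventually.of_forall fun q => ?_)
    simp only [Function.uncurry, hh]
    ring
  have hswap := integral_integral_swap hint
  have e1 : ∀ v, ∫ p, h p v ∂(ρX.prod ρX) =
      inner ℝ u (toL2 ρX (φ v)) * inner ℝ (toL2 ρX (φ v)) w := by
    intro v
    rw [real_inner_comm, inner_toL2_left (hφ2 v), inner_toL2_left (hφ2 v)]
    simp only [hh]
    rw [integral_prod_mul (fun x => u x * φ v x) (fun x => w x * φ v x)]
    simp only [mul_comm]
  -- `kernelIntegral` integrates over the first argument of `K`, so the coordinates appear in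
  -- swapped order.
  have hKφ' : ∀ᵐ p ∂ρX.prod ρX, K p.2 p.1 = ∫ v, φ v p.2 * φ v p.1 ∂μ :=
    (Measure.measurePreserving_swap (μ := ρX) (ν := ρX)).quasiMeasurePreserving.ae hKφ
  have e2 : ∀ᵐ p ∂ρX.prod ρX, ∫ v, h p v ∂μ = u p.1 * (w p.2 * K p.2 p.1) := by
    filter_upwards [hKφ'] with p hp
    rw [hp, ← integral_const_mul, ← integral_const_mul]
    refine integral_congr_ae (Filter.Eventually.of_forall fun v => ?_)
    simp only [hh]
    ring
  obtain ⟨hKm, M, hM⟩ := hK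
  have hint2 : Integrable (fun p : X × X => u p.1 * (w p.2 * K p.2 p.1)) (ρX.prod ρX) := by
    have h1 : Integrable (fun p : X × X => (u p.1 * w p.2) * K p.2 p.1) (ρX.prod ρX) :=
      huw.mul_bdd (c := M) (hKm.comp measurable_swap).aestronglyMeasurable
        (Filter.Eventually.of_forall fun q => hM _ _)
    exact h1.congr (Filter.Eventually.of_forall fun q => mul_assoc _ _ _)
  simp_rw [e1] at hswap
  rw [← hswap, integral_congr_ae e2, integral_prod _ hint2, inner_eq_integral]
  refine integral_congr_ae ?_
  filter_upwards [coeFn_integralOp ⟨hKm, M, hM⟩ w] with x hx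
  rw [hx, kernelIntegral, integral_const_mul]

end FeatureMap

/-! ### The regression function -/

section Regression

variable {X : Type*} [MeasurableSpace X] {ρ : Measure (X × ℝ)}

theorem memLp_snd (hy : Integrable (fun z : X × ℝ => z.2 ^ 2) ρ) :
    MemLp (fun z : X × ℝ => z.2) 2 ρ :=
  (memLp_two_iff_integrable_sq measurable_snd.aestronglyMeasurable).2 hy

theorem memLp_comp_fst {f : X → ℝ} (hf : MemLp f 2 ρ.fst) :
    MemLp (fun z : X × ℝ => f z.1) 2 ρ :=
  hf.comp_measurePreserving ⟨measurable_fst, rfl⟩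

theorem integral_comp_fst {f : X → ℝ} (hf : AEStronglyMeasurable f ρ.fst) :
    ∫ z, f z.1 ∂ρ = ∫ x, f x ∂ρ.fst := by
  rw [Measure.fst, integral_map measurable_fst.aemeasurable hf]

variable [IsProbabilityMeasure ρ]

/-- The regression function is the conditional mean of the output. -/
theorem integral_mul_snd {w : X → ℝ} (hw : MemLp w 2 ρ.fst)
    (hy : Integrable (fun z : X × ℝ => z.2 ^ 2) ρ) :
    ∫ z, w z.1 * z.2 ∂ρ = ∫ x, w x * regressionFun ρ x ∂ρ.fst := by
  have hi : Integrable (fun z : X × ℝ => w z.1 * z.2) ρ :=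
    (memLp_comp_fst hw).integrable_mul (memLp_snd hy)
  have hi' : Integrable (fun z : X × ℝ => w z.1 * z.2) (ρ.fst ⊗ₘ ρ.condKernel) := by
    rwa [Measure.disintegrate]
  conv_lhs => rw [← ρ.disintegrate ρ.condKernel]
  rw [Measure.integral_compProd hi']
  exact integral_congr_ae (Filter.Eventually.of_forall fun x => integral_const_mul (w x) _)

theorem integral_sub_snd_mul {h : Lp ℝ 2 ρ.fst} (hh : h =ᵐ[ρ.fst] regressionFun ρ)
    (hy : Integrable (fun z : X × ℝ => z.2 ^ 2) ρ) {f w : X → ℝ} (hf : MemLp f 2 ρ.fst)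
    (hw : MemLp w 2 ρ.fst) :
    ∫ z, (f z.1 - z.2) * w z.1 ∂ρ = inner ℝ (toL2 ρ.fst w) (toL2 ρ.fst f - h) := by
  have hi : Integrable (fun z : X × ℝ => w z.1 * z.2) ρ :=
    (memLp_comp_fst hw).integrable_mul (memLp_snd hy)
  have hi2 : Integrable (fun z : X × ℝ => w z.1 * f z.1) ρ :=
    (memLp_comp_fst hw).integrable_mul (memLp_comp_fst hf)
  have e1 : ∀ z : X × ℝ, (f z.1 - z.2) * w z.1 = w z.1 * f z.1 - w z.1 * z.2 := fun z => by ring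
  simp_rw [e1]
  rw [integral_sub hi2 hi, integral_mul_snd hw hy,
    integral_comp_fst (f := fun x => w x * f x) (hw.1.mul hf.1), inner_sub_right,
    inner_toL2_left hw, inner_toL2_left hw]
  congr 1
  · refine integral_congr_ae ?_
    filter_upwards [coeFn_toL2 hf] with x hx
    rw [hx]
  · refine integral_congr_ae ?_
    filter_upwards [hh] with x hx
    rw [hx]

/-- Split `f - y` at the regression function and use `(a + b)² ≤ 2 a² + 2 b²`. The resulting factor
`2` affects constants only. -/
theorem lintegral_sub_snd_sq_le {h : Lp ℝ 2 ρ.fst} (hh : h =ᵐ[ρ.fst] regressionFun ρ)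
    (hy : Integrable (fun z : X × ℝ => z.2 ^ 2) ρ) {f : X → ℝ} (hf : MemLp f 2 ρ.fst) {S : ℝ}
    (hS : risk ρ (regressionFun ρ) ≤ S) :
    ∫⁻ z, ENNReal.ofReal ((f z.1 - z.2) ^ 2) ∂ρ ≤
      ENNReal.ofReal (2 * ‖toL2 ρ.fst f - h‖ ^ 2 + 2 * S) := by
  have hr : MemLp (regressionFun ρ) 2 ρ.fst := (memLp_congr_ae hh).1 (Lp.memLp h)
  have i0 : Integrable (fun z : X × ℝ => (f z.1 - z.2) ^ 2) ρ :=
    ((memLp_comp_fst hf).sub (memLp_snd hy)).integrable_sq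
  have i1 : Integrable (fun z : X × ℝ => (f z.1 - regressionFun ρ z.1) ^ 2) ρ :=
    ((memLp_comp_fst hf).sub (memLp_comp_fst hr)).integrable_sq
  have i2 : Integrable (fun z : X × ℝ => (regressionFun ρ z.1 - z.2) ^ 2) ρ :=
    ((memLp_comp_fst hr).sub (memLp_snd hy)).integrable_sq
  rw [← ofReal_integral_eq_lintegral_ofReal i0 (Filter.Eventually.of_forall fun z => sq_nonneg _)]
  refine ENNReal.ofReal_le_ofReal ?_
  have e : ‖toL2 ρ.fst f - h‖ ^ 2 = ∫ z, (f z.1 - regressionFun ρ z.1) ^ 2 ∂ρ := by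
    rw [integral_comp_fst (f := fun x => (f x - regressionFun ρ x) ^ 2) ((hf.sub hr).1.pow 2),
      norm_toL2_sub_sq hf]
    refine integral_congr_ae ?_
    filter_upwards [hh] with x hx
    rw [hx]
  calc _ ≤ ∫ z, (2 * (f z.1 - regressionFun ρ z.1) ^ 2 + 2 * (regressionFun ρ z.1 - z.2) ^ 2) ∂ρ :=
        integral_mono i0 ((i1.const_mul 2).add (i2.const_mul 2)) fun z => by
          simp only
          nlinarith [sq_nonneg (f z.1 - regressionFun ρ z.1 - (regressionFun ρ z.1 - z.2))]
    _ = 2 * ‖toL2 ρ.fst f - h‖ ^ 2 + 2 * risk ρ (regressionFun ρ) := by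
        rw [integral_add (i1.const_mul 2) (i2.const_mul 2), integral_const_mul, integral_const_mul, e,
          risk]
    _ ≤ _ := by linarith

theorem sqDist_eq {h : Lp ℝ 2 ρ.fst} (hh : h =ᵐ[ρ.fst] regressionFun ρ) {f : X → ℝ}
    (hf : MemLp f 2 ρ.fst) :
    sqDist ρ.fst f (regressionFun ρ) = ENNReal.ofReal (‖toL2 ρ.fst f - h‖ ^ 2) := by
  have hi : Integrable (fun x => (f x - h x) ^ 2) ρ.fst := (hf.sub (Lp.memLp h)).integrable_sq
  rw [norm_toL2_sub_sq hf, ofReal_integral_eq_lintegral_ofReal hi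
    (Filter.Eventually.of_forall fun z => sq_nonneg _), sqDist]
  refine lintegral_congr_ae ?_
  filter_upwards [hh] with x hx
  rw [hx]

end Regression

/-! ### One step of the algorithm -/

section Step

variable {X V : Type*} [MeasurableSpace X] [MeasurableSpace V]
  {ρ : Measure (X × ℝ)} {μ : Measure V} [IsProbabilityMeasure μ]
  {φ : V → X → ℝ} {κ : ℝ} {L : Lp ℝ 2 ρ.fst →L[ℝ] Lp ℝ 2 ρ.fst} {h : Lp ℝ 2 ρ.fst}

theorem memLp_gradientFactor (hφ : Measurable (Function.uncurry φ)) (hφκ : ∀ v x, |φ v x| ≤ κ)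
    (hy : Integrable (fun z : X × ℝ => z.2 ^ 2) ρ) {f : X → ℝ} (hf : MemLp f 2 ρ.fst) :
    MemLp (fun ω : (X × ℝ) × V => (f ω.1.1 - ω.1.2) * φ ω.2 ω.1.1) 2 (ρ.prod μ) := by
  have h1 : MemLp (fun z : X × ℝ => f z.1 - z.2) 2 ρ := (memLp_comp_fst hf).sub (memLp_snd hy)
  have h2 : MemLp (fun ω : (X × ℝ) × V => f ω.1.1 - ω.1.2) 2 (ρ.prod μ) :=
    h1.comp_measurePreserving measurePreserving_fst
  have h3 : Measurable fun ω : (X × ℝ) × V => φ ω.2 ω.1.1 :=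
    hφ.comp (measurable_snd.prodMk (measurable_fst.comp measurable_fst))
  exact MemLp.mul (p := 2) (q := ∞) (r := 2) (memLp_top_of_bound h3.aestronglyMeasurable κ
    (Filter.Eventually.of_forall fun ω => hφκ _ _)) h2

variable [IsProbabilityMeasure ρ]

theorem norm_featureMap_le (hκ : 0 ≤ κ) (hφ : Measurable (Function.uncurry φ))
    (hφκ : ∀ v x, |φ v x| ≤ κ) (v : V) : ‖toL2 ρ.fst (φ v)‖ ≤ κ :=
  norm_toL2_le (memLp_of_forall_abs_le (measurable_feature_left hφ v) (hφκ v) 2) hκ (hφκ v)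

/-- The function after one step of the algorithm from `f` with sample `ω`. -/
def stepFun (φ : V → X → ℝ) (η lam : ℝ) (f : X → ℝ) (ω : (X × ℝ) × V) (x : X) : ℝ :=
  (1 - η * lam) * f x - η * (f ω.1.1 - ω.1.2) * φ ω.2 ω.1.1 * φ ω.2 x

theorem toL2_stepFun (hφ : Measurable (Function.uncurry φ)) (hφκ : ∀ v x, |φ v x| ≤ κ)
    {f : X → ℝ} (hf : MemLp f 2 ρ.fst) (η lam : ℝ) (ω : (X × ℝ) × V) :
    toL2 ρ.fst (stepFun φ η lam f ω) = (1 - η * lam) • toL2 ρ.fst f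
      - η • ((f ω.1.1 - ω.1.2) * φ ω.2 ω.1.1) • toL2 ρ.fst (φ ω.2) := by
  have hφ2 : MemLp (φ ω.2) 2 ρ.fst :=
    memLp_of_forall_abs_le (measurable_feature_left hφ ω.2) (hφκ ω.2) 2
  have hs : MemLp (stepFun φ η lam f ω) 2 ρ.fst := (hf.const_mul _).sub (hφ2.const_mul _)
  rw [toL2, dif_pos hs, toL2, dif_pos hf, toL2, dif_pos hφ2, ← MemLp.toLp_const_smul,
    ← MemLp.toLp_const_smul, ← MemLp.toLp_const_smul, ← MemLp.toLp_sub]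
  refine MemLp.toLp_congr _ _ (Filter.Eventually.of_forall fun x => ?_)
  simp only [stepFun, Pi.sub_apply, Pi.smul_apply, smul_eq_mul]
  ring

variable [StandardBorelSpace X]

/-- A standard Borel σ-algebra is countably generated, which makes `L²` separable. Measurability of
the `L²`-valued iterates and the trace computation rest on this. -/
instance secondCountableTopology_L2 {ρX : Measure X} [IsFiniteMeasure ρX] :
    SecondCountableTopology (Lp ℝ 2 ρX) :=
  have : Fact ((2 : ℝ≥0∞) ≠ ∞) := ⟨by norm_num⟩
  inferInstance

theorem stronglyMeasurable_featureMap (hφ : Measurable (Function.uncurry φ))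
    (hφκ : ∀ v x, |φ v x| ≤ κ) : StronglyMeasurable fun v => toL2 ρ.fst (φ v) :=
  stronglyMeasurable_toL2 hφ fun v =>
    memLp_of_forall_abs_le (measurable_feature_left hφ v) (hφκ v) 2

/-- Integrating over `z` with `v` fixed gives `⟪φ_v, f - h⟫`; averaging over `v` then produces `L`.
Thus the doubly random gradient is unbiased. -/
theorem integral_gradient (hφ : Measurable (Function.uncurry φ)) (hφκ : ∀ v x, |φ v x| ≤ κ)
    (hκ : 0 ≤ κ)
    (hL : ∀ u w, inner ℝ u (L w) =
      ∫ v, inner ℝ u (toL2 ρ.fst (φ v)) * inner ℝ (toL2 ρ.fst (φ v)) w ∂μ)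
    (hh : h =ᵐ[ρ.fst] regressionFun ρ) (hy : Integrable (fun z : X × ℝ => z.2 ^ 2) ρ) {f : X → ℝ}
    (hf : MemLp f 2 ρ.fst) (w : Lp ℝ 2 ρ.fst) :
    ∫ ω : (X × ℝ) × V, (f ω.1.1 - ω.1.2) * φ ω.2 ω.1.1 * inner ℝ (toL2 ρ.fst (φ ω.2)) w
      ∂(ρ.prod μ) = inner ℝ (L (toL2 ρ.fst f - h)) w := by
  have hΦ := stronglyMeasurable_featureMap (ρ := ρ) hφ hφκ
  have hΦκ := norm_featureMap_le (ρ := ρ) hκ hφ hφκ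
  have hi : Integrable (fun ω : (X × ℝ) × V =>
      (f ω.1.1 - ω.1.2) * φ ω.2 ω.1.1 * inner ℝ (toL2 ρ.fst (φ ω.2)) w) (ρ.prod μ) := by
    refine ((memLp_gradientFactor hφ hφκ hy hf).integrable (by norm_num)).mul_bdd (c := κ * ‖w‖)
      ((hΦ.inner stronglyMeasurable_const).comp_measurable measurable_snd).aestronglyMeasurable
      (Filter.Eventually.of_forall fun ω => ?_)
    exact (norm_inner_le_norm _ _).trans (mul_le_mul_of_nonneg_right (hΦκ _) (norm_nonneg _))
  rw [integral_prod_symm _ hi, real_inner_comm, hL]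
  refine integral_congr_ae (Filter.Eventually.of_forall fun v => ?_)
  simp only
  rw [integral_mul_const, integral_sub_snd_mul hh hy hf
    (memLp_of_forall_abs_le (measurable_feature_left hφ v) (hφκ v) 2), real_inner_comm w, mul_comm]

/-- Bias-variance for one step. In the second moment `φ_v(x)²` is replaced by `κ²`; the remaining
factors depend on `z` alone and on `v` alone, so independence splits the integral into a risk and a
feature trace. -/
theorem lintegral_step_le (hφ : Measurable (Function.uncurry φ)) (hφκ : ∀ v x, |φ v x| ≤ κ)
    (hκ : 0 ≤ κ)
    (hL : ∀ u w, inner ℝ u (L w) =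
      ∫ v, inner ℝ u (toL2 ρ.fst (φ v)) * inner ℝ (toL2 ρ.fst (φ v)) w ∂μ)
    (hh : h =ᵐ[ρ.fst] regressionFun ρ) (hy : Integrable (fun z : X × ℝ => z.2 ^ 2) ρ) {f : X → ℝ}
    (hf : MemLp f 2 ρ.fst) (B : Lp ℝ 2 ρ.fst →L[ℝ] Lp ℝ 2 ρ.fst) {η lam : ℝ} {p : Lp ℝ 2 ρ.fst}
    (hp : L p + lam • p = L h) :
    ∫⁻ ω, ENNReal.ofReal (‖B (toL2 ρ.fst (stepFun φ η lam f ω) - p)‖ ^ 2) ∂(ρ.prod μ) ≤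
      ENNReal.ofReal (‖(B * (1 - η • (L + lam • (1 : Lp ℝ 2 ρ.fst →L[ℝ] Lp ℝ 2 ρ.fst))))
          (toL2 ρ.fst f - p)‖ ^ 2)
        + ENNReal.ofReal (η ^ 2 * κ ^ 2)
          * ((∫⁻ z, ENNReal.ofReal ((f z.1 - z.2) ^ 2) ∂ρ)
            * ∫⁻ v, ENNReal.ofReal (‖B (toL2 ρ.fst (φ v))‖ ^ 2) ∂μ) := by
  have hΦ := stronglyMeasurable_featureMap (ρ := ρ) hφ hφκ
  have hΦκ := norm_featureMap_le (ρ := ρ) hκ hφ hφκ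
  have h1 := lintegral_norm_map_sub_sq_le (μ := ρ.prod μ)
    (Φ := fun ω : (X × ℝ) × V => toL2 ρ.fst (φ ω.2)) (hΦ.comp_measurable measurable_snd)
    (fun ω => hΦκ ω.2) (memLp_gradientFactor (μ := μ) hφ hφκ hy hf)
    (integral_gradient hφ hφκ hκ hL hh hy hf) B ((1 - η * lam) • toL2 ρ.fst f - p) η
  have e1 : ∀ ω : (X × ℝ) × V, toL2 ρ.fst (stepFun φ η lam f ω) - p =
      (1 - η * lam) • toL2 ρ.fst f - p
        - η • ((f ω.1.1 - ω.1.2) * φ ω.2 ω.1.1) • toL2 ρ.fst (φ ω.2) := by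
    intro ω
    rw [toL2_stepFun hφ hφκ hf]
    abel
  -- The equation for `p` removes the inhomogeneous term: `p` is the fixed point of the mean step.
  have e2 : B ((1 - η * lam) • toL2 ρ.fst f - p - η • L (toL2 ρ.fst f - h)) =
      (B * (1 - η • (L + lam • (1 : Lp ℝ 2 ρ.fst →L[ℝ] Lp ℝ 2 ρ.fst)))) (toL2 ρ.fst f - p) := by
    rw [mul_apply_eq_comp]
    congr 1
    rw [map_sub, ← hp]
    simp only [sub_apply, smul_apply, add_apply, one_apply_eq_self, map_sub]
    module
  simp_rw [e1]
  refine h1.trans ?_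
  rw [e2]
  refine add_le_add le_rfl ?_
  have hm1 : AEMeasurable (fun z : X × ℝ => ENNReal.ofReal ((f z.1 - z.2) ^ 2)) ρ :=
    (((memLp_comp_fst hf).sub (memLp_snd hy)).1.aemeasurable.pow_const 2).ennreal_ofReal
  have hm2 : AEMeasurable (fun v => ENNReal.ofReal (‖B (toL2 ρ.fst (φ v))‖ ^ 2)) μ :=
    ((B.continuous.comp_stronglyMeasurable hΦ).norm.measurable.pow_const 2
      ).ennreal_ofReal.aemeasurable
  rw [← lintegral_prod_mul hm1 hm2, ← lintegral_const_mul' _ _ ENNReal.ofReal_ne_top]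
  refine lintegral_mono fun ω => ?_
  simp only
  rw [← ENNReal.ofReal_mul (sq_nonneg _), ← ENNReal.ofReal_mul (by positivity)]
  refine ENNReal.ofReal_le_ofReal ?_
  have h3 : φ ω.2 ω.1.1 ^ 2 ≤ κ ^ 2 := by
    rw [← sq_abs]
    exact pow_le_pow_left₀ (abs_nonneg _) (hφκ _ _) 2
  calc _ = (η ^ 2 * ((f ω.1.1 - ω.1.2) ^ 2 * ‖B (toL2 ρ.fst (φ ω.2))‖ ^ 2)) * φ ω.2 ω.1.1 ^ 2 := by
        ring
    _ ≤ (η ^ 2 * ((f ω.1.1 - ω.1.2) ^ 2 * ‖B (toL2 ρ.fst (φ ω.2))‖ ^ 2)) * κ ^ 2 :=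
        mul_le_mul_of_nonneg_left h3 (by positivity)
    _ = _ := by ring

end Step

/-! ### Splitting off the last sample -/

section Pi

variable {Y : Type*} [MeasurableSpace Y]

theorem measurable_init (t : ℕ) :
    Measurable (Fin.init : (Fin (t + 1) → Y) → Fin t → Y) :=
  measurable_pi_lambda _ fun i => measurable_pi_apply i.castSucc

theorem measurePreserving_init_last (ν : Measure Y) [SigmaFinite ν]
    (t : ℕ) : MeasurePreserving (fun s : Fin (t + 1) → Y => (s (Fin.last t), Fin.init s))
      (Measure.pi fun _ => ν) (ν.prod (Measure.pi fun _ => ν)) := by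
  have h := measurePreserving_piFinSuccAbove (fun _ : Fin (t + 1) => ν) (Fin.last t)
  convert h using 2 with s
  ext i
  · rfl
  · simp [Fin.init, MeasurableEquiv.piFinSuccAbove]

theorem lintegral_pi_succ (ν : Measure Y) [SigmaFinite ν] (t : ℕ)
    {G : (Fin t → Y) → Y → ℝ≥0∞} (hG : Measurable (Function.uncurry G)) :
    ∫⁻ s, G (Fin.init s) (s (Fin.last t)) ∂(Measure.pi fun _ : Fin (t + 1) => ν) =
      ∫⁻ s, ∫⁻ y, G s y ∂ν ∂(Measure.pi fun _ : Fin t => ν) := by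
  have hG' : Measurable fun p : Y × (Fin t → Y) => G p.2 p.1 := hG.comp measurable_swap
  rw [← lintegral_prod_symm' _ hG', ← (measurePreserving_init_last ν t).lintegral_comp hG']

end Pi

/-! ### The iterates -/

section Iterates

variable {X V : Type*} {φ : V → X → ℝ} {η : ℕ → ℝ} {lam κ : ℝ}

theorem iterate_succ (t : ℕ) (s : Fin (t + 1) → (X × ℝ) × V) :
    iterate φ η lam (t + 1) s =
      stepFun φ (η (t + 1)) lam (iterate φ η lam t (Fin.init s)) (s (Fin.last t)) := rfl

/-- The bound depends on the sample, since outputs are unbounded; it serves only to place each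
iterate in `L²`. -/
theorem exists_abs_iterate_le (hφκ : ∀ v x, |φ v x| ≤ κ) (t : ℕ) (s : Fin t → (X × ℝ) × V) :
    ∃ M, ∀ x, |iterate φ η lam t s x| ≤ M := by
  induction t with
  | zero => exact ⟨0, fun x => by simp [iterate]⟩
  | succ t ih =>
    obtain ⟨M, hM⟩ := ih (Fin.init s)
    simp only [iterate_succ, stepFun]
    refine ⟨|1 - η (t + 1) * lam| * M
      + |η (t + 1) * (iterate φ η lam t (Fin.init s) (s (Fin.last t)).1.1
        - (s (Fin.last t)).1.2) * φ (s (Fin.last t)).2 (s (Fin.last t)).1.1| * κ,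
      fun x => (abs_sub _ _).trans (add_le_add ?_ ?_)⟩
    · rw [abs_mul]
      exact mul_le_mul_of_nonneg_left (hM x) (abs_nonneg _)
    · rw [abs_mul]
      exact mul_le_mul_of_nonneg_left (hφκ _ x) (abs_nonneg _)

variable [MeasurableSpace X] [MeasurableSpace V]

theorem measurable_iterate (hφ : Measurable (Function.uncurry φ)) (t : ℕ) :
    Measurable fun p : (Fin t → (X × ℝ) × V) × X => iterate φ η lam t p.1 p.2 := by
  induction t with
  | zero => exact measurable_const
  | succ t ih =>
    simp only [iterate_succ, stepFun]
    have hi : Measurable fun p : (Fin (t + 1) → (X × ℝ) × V) × X => Fin.init p.1 :=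
      (measurable_init t).comp measurable_fst
    have hl : Measurable fun p : (Fin (t + 1) → (X × ℝ) × V) × X => p.1 (Fin.last t) :=
      (measurable_pi_apply _).comp measurable_fst
    have h1 := ih.comp (hi.prodMk measurable_snd)
    have h2 := ih.comp (hi.prodMk hl.fst.fst)
    have h3 := hφ.comp (hl.snd.prodMk hl.fst.fst)
    have h4 := hφ.comp (hl.snd.prodMk measurable_snd)
    exact (h1.const_mul _).sub ((((h2.sub hl.fst.snd).const_mul _).mul h3).mul h4)

theorem memLp_iterate {ρX : Measure X} [IsFiniteMeasure ρX] (hφ : Measurable (Function.uncurry φ))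
    (hφκ : ∀ v x, |φ v x| ≤ κ) (t : ℕ) (s : Fin t → (X × ℝ) × V) :
    MemLp (iterate φ η lam t s) 2 ρX := by
  obtain ⟨M, hM⟩ := exists_abs_iterate_le (η := η) (lam := lam) hφκ t s
  exact memLp_of_forall_abs_le ((measurable_iterate hφ t).comp measurable_prodMk_left) hM 2

end Iterates

/-! ### Expected errors of the iterates -/

section Expectation

variable {X V : Type*} [MeasurableSpace X] [MeasurableSpace V]

/-- The expectation of `‖B (f_{t+1} - p)‖²`. -/
def meanSqDist (ρ : Measure (X × ℝ)) (μ : Measure V) (φ : V → X → ℝ) (η : ℕ → ℝ) (lam : ℝ)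
    (p : Lp ℝ 2 ρ.fst) (B : Lp ℝ 2 ρ.fst →L[ℝ] Lp ℝ 2 ρ.fst) (t : ℕ) : ℝ≥0∞ :=
  ∫⁻ s, ENNReal.ofReal (‖B (toL2 ρ.fst (iterate φ η lam t s) - p)‖ ^ 2)
    ∂(Measure.pi fun _ : Fin t => ρ.prod μ)

/-- The expectation of the risk of `f_{t+1}`. -/
def meanRisk (ρ : Measure (X × ℝ)) (μ : Measure V) (φ : V → X → ℝ) (η : ℕ → ℝ) (lam : ℝ)
    (t : ℕ) : ℝ≥0∞ :=
  ∫⁻ s, ∫⁻ z, ENNReal.ofReal ((iterate φ η lam t s z.1 - z.2) ^ 2) ∂ρ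
    ∂(Measure.pi fun _ : Fin t => ρ.prod μ)

/-- The second moment `E ‖B φ_v‖²` of a transformed random feature. -/
def featureTrace (ρX : Measure X) (μ : Measure V) (φ : V → X → ℝ)
    (B : Lp ℝ 2 ρX →L[ℝ] Lp ℝ 2 ρX) : ℝ≥0∞ :=
  ∫⁻ v, ENNReal.ofReal (‖B (toL2 ρX (φ v))‖ ^ 2) ∂μ

variable {ρ : Measure (X × ℝ)} [IsProbabilityMeasure ρ] {μ : Measure V}
  [IsProbabilityMeasure μ] {φ : V → X → ℝ} {κ : ℝ} {L : Lp ℝ 2 ρ.fst →L[ℝ] Lp ℝ 2 ρ.fst}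
  {h p : Lp ℝ 2 ρ.fst} {η : ℕ → ℝ} {lam : ℝ}

theorem meanSqDist_zero (B : Lp ℝ 2 ρ.fst →L[ℝ] Lp ℝ 2 ρ.fst) :
    meanSqDist ρ μ φ η lam p B 0 = ENNReal.ofReal (‖B p‖ ^ 2) := by
  have h0 : toL2 ρ.fst (fun _ => (0 : ℝ)) = 0 := by
    rw [toL2, dif_pos MemLp.zero']
    exact MemLp.toLp_zero _
  simp only [meanSqDist, iterate, h0, zero_sub, map_neg, norm_neg]
  simp

theorem meanRisk_le (hφ : Measurable (Function.uncurry φ)) (hφκ : ∀ v x, |φ v x| ≤ κ)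
    (hh : h =ᵐ[ρ.fst] regressionFun ρ) (hy : Integrable (fun z : X × ℝ => z.2 ^ 2) ρ) {S : ℝ}
    (hS : risk ρ (regressionFun ρ) ≤ S) (t : ℕ) :
    meanRisk ρ μ φ η lam t ≤ ENNReal.ofReal 4 * meanSqDist ρ μ φ η lam p 1 t
      + ENNReal.ofReal (4 * ‖p - h‖ ^ 2 + 2 * S) := by
  have hS0 : 0 ≤ S := (integral_nonneg fun z => sq_nonneg _).trans hS
  rw [meanRisk, meanSqDist, ← lintegral_const_mul' _ _ ENNReal.ofReal_ne_top]
  have e : ENNReal.ofReal (4 * ‖p - h‖ ^ 2 + 2 * S) =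
      ∫⁻ _ : Fin t → (X × ℝ) × V, ENNReal.ofReal (4 * ‖p - h‖ ^ 2 + 2 * S)
        ∂(Measure.pi fun _ => ρ.prod μ) := by simp
  rw [e, ← lintegral_add_right _ measurable_const]
  refine lintegral_mono fun s => ?_
  refine (lintegral_sub_snd_sq_le hh hy (memLp_iterate hφ hφκ t s) hS).trans ?_
  rw [← ENNReal.ofReal_mul (by norm_num), ← ENNReal.ofReal_add (by positivity) (by positivity)]
  refine ENNReal.ofReal_le_ofReal ?_
  rw [one_apply_eq_self]
  set f := toL2 ρ.fst (iterate φ η lam t s)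
  have h1 : ‖f - h‖ ≤ ‖f - p‖ + ‖p - h‖ := norm_sub_le_norm_sub_add_norm_sub _ _ _
  nlinarith [norm_nonneg (f - h), sq_nonneg (‖f - p‖ - ‖p - h‖)]

theorem lintegral_sqDist_le (hφ : Measurable (Function.uncurry φ)) (hφκ : ∀ v x, |φ v x| ≤ κ)
    (hh : h =ᵐ[ρ.fst] regressionFun ρ) (t : ℕ) :
    ∫⁻ s, sqDist ρ.fst (iterate φ η lam t s) (regressionFun ρ)
        ∂(Measure.pi fun _ : Fin t => ρ.prod μ) ≤
      ENNReal.ofReal 2 * meanSqDist ρ μ φ η lam p 1 t + ENNReal.ofReal (2 * ‖p - h‖ ^ 2) := by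
  rw [meanSqDist, ← lintegral_const_mul' _ _ ENNReal.ofReal_ne_top]
  have e : ENNReal.ofReal (2 * ‖p - h‖ ^ 2) =
      ∫⁻ _ : Fin t → (X × ℝ) × V, ENNReal.ofReal (2 * ‖p - h‖ ^ 2)
        ∂(Measure.pi fun _ => ρ.prod μ) := by simp
  rw [e, ← lintegral_add_right _ measurable_const]
  refine lintegral_mono fun s => ?_
  simp only
  rw [sqDist_eq hh (memLp_iterate hφ hφκ t s), ← ENNReal.ofReal_mul (by norm_num),
    ← ENNReal.ofReal_add (by positivity) (by positivity)]
  refine ENNReal.ofReal_le_ofReal ?_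
  rw [one_apply_eq_self]
  set f := toL2 ρ.fst (iterate φ η lam t s)
  have h1 : ‖f - h‖ ≤ ‖f - p‖ + ‖p - h‖ := norm_sub_le_norm_sub_add_norm_sub _ _ _
  nlinarith [norm_nonneg (f - h), sq_nonneg (‖f - p‖ - ‖p - h‖)]

variable [StandardBorelSpace X]

theorem meanSqDist_succ_le (hφ : Measurable (Function.uncurry φ)) (hφκ : ∀ v x, |φ v x| ≤ κ)
    (hκ : 0 ≤ κ)
    (hL : ∀ u w, inner ℝ u (L w) =
      ∫ v, inner ℝ u (toL2 ρ.fst (φ v)) * inner ℝ (toL2 ρ.fst (φ v)) w ∂μ)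
    (hh : h =ᵐ[ρ.fst] regressionFun ρ) (hy : Integrable (fun z : X × ℝ => z.2 ^ 2) ρ)
    (hp : L p + lam • p = L h) (B : Lp ℝ 2 ρ.fst →L[ℝ] Lp ℝ 2 ρ.fst) (t : ℕ) :
    meanSqDist ρ μ φ η lam p B (t + 1) ≤
      meanSqDist ρ μ φ η lam p
          (B * (1 - η (t + 1) • (L + lam • (1 : Lp ℝ 2 ρ.fst →L[ℝ] Lp ℝ 2 ρ.fst)))) t
        + ENNReal.ofReal (η (t + 1) ^ 2 * κ ^ 2)
          * (meanRisk ρ μ φ η lam t * featureTrace ρ.fst μ φ B) := by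
  have hstep : Measurable (Function.uncurry fun (q : (Fin t → (X × ℝ) × V) × ((X × ℝ) × V)) =>
      stepFun φ (η (t + 1)) lam (iterate φ η lam t q.1) q.2) := by
    have hit := measurable_iterate (η := η) (lam := lam) hφ t
    have hq : Measurable fun r : ((Fin t → (X × ℝ) × V) × ((X × ℝ) × V)) × X => r.1.2 :=
      measurable_fst.snd
    have hr : Measurable fun r : ((Fin t → (X × ℝ) × V) × ((X × ℝ) × V)) × X => r.1.1 :=
      measurable_fst.fst
    have h1 := hit.comp (hr.prodMk measurable_snd)
    have h2 := hit.comp (hr.prodMk hq.fst.fst)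
    have h3 := hφ.comp (hq.snd.prodMk hq.fst.fst)
    have h4 := hφ.comp (hq.snd.prodMk measurable_snd)
    exact (h1.const_mul _).sub ((((h2.sub hq.fst.snd).const_mul _).mul h3).mul h4)
  have hmem : ∀ q : (Fin t → (X × ℝ) × V) × ((X × ℝ) × V),
      MemLp (stepFun φ (η (t + 1)) lam (iterate φ η lam t q.1) q.2) 2 ρ.fst := fun q =>
    ((memLp_iterate hφ hφκ t q.1).const_mul _).sub
      ((memLp_of_forall_abs_le (measurable_feature_left hφ q.2.2) (hφκ _) 2).const_mul _)
  have hG : Measurable (Function.uncurry fun (s : Fin t → (X × ℝ) × V) (ω : (X × ℝ) × V) =>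
      ENNReal.ofReal (‖B (toL2 ρ.fst (stepFun φ (η (t + 1)) lam (iterate φ η lam t s) ω)
        - p)‖ ^ 2)) :=
    ((B.continuous.comp_stronglyMeasurable ((stronglyMeasurable_toL2 hstep hmem).sub
      stronglyMeasurable_const)).norm.measurable.pow_const 2).ennreal_ofReal
  have hR : Measurable fun s : Fin t → (X × ℝ) × V =>
      ∫⁻ z, ENNReal.ofReal ((iterate φ η lam t s z.1 - z.2) ^ 2) ∂ρ := by
    refine Measurable.lintegral_prod_right' (f := fun q : (Fin t → (X × ℝ) × V) × (X × ℝ) =>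
      ENNReal.ofReal ((iterate φ η lam t q.1 q.2.1 - q.2.2) ^ 2)) ?_
    exact ((((measurable_iterate hφ t).comp (measurable_fst.prodMk measurable_snd.fst)).sub
      measurable_snd.snd).pow_const 2).ennreal_ofReal
  have e := lintegral_pi_succ (ρ.prod μ) t hG
  simp only [← iterate_succ] at e
  rw [meanSqDist, e]
  refine (lintegral_mono fun s => lintegral_step_le (μ := μ) (η := η (t + 1)) hφ hφκ hκ hL hh hy
    (memLp_iterate hφ hφκ t s) B hp).trans ?_
  have hm : Measurable fun s : Fin t → (X × ℝ) × V => ENNReal.ofReal (η (t + 1) ^ 2 * κ ^ 2)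
      * ((∫⁻ z, ENNReal.ofReal ((iterate φ η lam t s z.1 - z.2) ^ 2) ∂ρ)
        * ∫⁻ v, ENNReal.ofReal (‖B (toL2 ρ.fst (φ v))‖ ^ 2) ∂μ) := (hR.mul_const _).const_mul _
  rw [lintegral_add_right _ hm, lintegral_const_mul _ (hR.mul_const _), lintegral_mul_const _ hR]
  rfl

/-- Peeling off the last step replaces `B` by `B (1 - η (L + λ))`, so the induction needs arbitrary
`B`. The index `j - 1` in `meanRisk` refers to `f_j`, the function on which step `j` acts. -/
theorem meanSqDist_le_sum (hφ : Measurable (Function.uncurry φ)) (hφκ : ∀ v x, |φ v x| ≤ κ)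
    (hκ : 0 ≤ κ)
    (hL : ∀ u w, inner ℝ u (L w) =
      ∫ v, inner ℝ u (toL2 ρ.fst (φ v)) * inner ℝ (toL2 ρ.fst (φ v)) w ∂μ)
    (hh : h =ᵐ[ρ.fst] regressionFun ρ) (hy : Integrable (fun z : X × ℝ => z.2 ^ 2) ρ)
    (hp : L p + lam • p = L h) (B : Lp ℝ 2 ρ.fst →L[ℝ] Lp ℝ 2 ρ.fst) (t : ℕ) :
    meanSqDist ρ μ φ η lam p B t ≤ ENNReal.ofReal (‖(B * propagator L lam η 0 t) p‖ ^ 2)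
      + ∑ j ∈ Finset.Ioc 0 t, ENNReal.ofReal (η j ^ 2 * κ ^ 2)
        * (meanRisk ρ μ φ η lam (j - 1)
          * featureTrace ρ.fst μ φ (B * propagator L lam η j t)) := by
  induction t generalizing B with
  | zero => simp [meanSqDist_zero, propagator_self]
  | succ t ih =>
    refine (meanSqDist_succ_le hφ hφκ hκ hL hh hy hp B t).trans ?_
    refine (add_le_add (ih _) le_rfl).trans (le_of_eq ?_)
    rw [Finset.sum_Ioc_succ_top (Nat.zero_le t), propagator_self, mul_one, Nat.add_sub_cancel,
      propagator_succ (Nat.zero_le t), ← mul_assoc B, ← add_assoc]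
    congr 2
    refine Finset.sum_congr rfl fun j hj => ?_
    rw [propagator_succ (Finset.mem_Ioc.1 hj).2, ← mul_assoc B]

end Expectation

/-! ### Almost everywhere equal features -/

section Congr

variable {X V : Type*} {φ φ' : V → X → ℝ} {η : ℕ → ℝ} {lam κ : ℝ}

/-- The features truncated to `[-κ, κ]`. -/
def clip (κ : ℝ) (φ : V → X → ℝ) (v : V) (x : X) : ℝ := max (-κ) (min κ (φ v x))

theorem abs_clip_le (hκ : 0 ≤ κ) (v : V) (x : X) : |clip κ φ v x| ≤ κ := by
  rw [abs_le]
  exact ⟨le_max_left _ _, max_le (by linarith) (min_le_left _ _)⟩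

variable [MeasurableSpace X] [MeasurableSpace V] {ρ : Measure (X × ℝ)} {μ : Measure V}

theorem measurable_clip (hφ : Measurable (Function.uncurry φ)) :
    Measurable (Function.uncurry (clip κ φ)) :=
  measurable_const.max (measurable_const.min hφ)

theorem ae_iterate_eq [IsProbabilityMeasure ρ] [IsProbabilityMeasure μ]
    (hφ : ∀ᵐ q ∂μ.prod ρ.fst, φ q.1 q.2 = φ' q.1 q.2) (t : ℕ) :
    ∀ᵐ q ∂(Measure.pi fun _ : Fin t => ρ.prod μ).prod ρ.fst,
      iterate φ η lam t q.1 q.2 = iterate φ' η lam t q.1 q.2 := by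
  induction t with
  | zero => exact Filter.Eventually.of_forall fun q => rfl
  | succ t ih =>
    have m0 := (measurePreserving_init_last (ρ.prod μ) t).prod (MeasurePreserving.id ρ.fst)
    have mx : MeasurePreserving (Prod.fst : X × ℝ → X) ρ ρ.fst := ⟨measurable_fst, rfl⟩
    have mω : MeasurePreserving (fun ω : (X × ℝ) × V => (ω.2, ω.1.1)) (ρ.prod μ) (μ.prod ρ.fst) :=
      ((MeasurePreserving.id μ).prod mx).comp Measure.measurePreserving_swap
    -- The new iterate evaluates the old one at `x` and `x_t`, and the feature at `(v_t, x)` and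
    -- `(v_t, x_t)`. By independence each of the four pairs has the product law under which equality
    -- is known.
    have q1 := (measurePreserving_snd.prod (MeasurePreserving.id ρ.fst)).comp m0
    have q2 := (((MeasurePreserving.id (Measure.pi fun _ : Fin t => ρ.prod μ)).prod
      (mx.comp measurePreserving_fst)).comp Measure.measurePreserving_swap).comp
      (measurePreserving_fst.comp m0)
    have q3 := ((measurePreserving_snd.comp measurePreserving_fst).prod
      (MeasurePreserving.id ρ.fst)).comp m0
    have q4 := mω.comp (measurePreserving_fst.comp (measurePreserving_fst.comp m0))
    filter_upwards [q1.quasiMeasurePreserving.ae ih, q2.quasiMeasurePreserving.ae ih,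
      q3.quasiMeasurePreserving.ae hφ, q4.quasiMeasurePreserving.ae hφ] with q h1 h2 h3 h4
    simp only [Function.comp_apply, Prod.map, id_eq, Prod.swap] at h1 h2 h3 h4
    simp only [iterate_succ, stepFun, h1, h2, h3, h4]

theorem lintegral_sqDist_congr [IsProbabilityMeasure ρ] [IsProbabilityMeasure μ]
    (hφ : ∀ᵐ q ∂μ.prod ρ.fst, φ q.1 q.2 = φ' q.1 q.2) (t : ℕ)
    (g : X → ℝ) :
    ∫⁻ s, sqDist ρ.fst (iterate φ η lam t s) g ∂(Measure.pi fun _ : Fin t => ρ.prod μ) =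
      ∫⁻ s, sqDist ρ.fst (iterate φ' η lam t s) g ∂(Measure.pi fun _ : Fin t => ρ.prod μ) := by
  refine lintegral_congr_ae ?_
  filter_upwards [Measure.ae_ae_of_ae_prod (ae_iterate_eq (η := η) (lam := lam) hφ t)] with s hs
  refine lintegral_congr_ae ?_
  filter_upwards [hs] with x hx
  rw [hx]

/-- If `A` is `{f > κ}` or `{f < -κ}`, the product exceeds `κ²` on all of `A × A`, so `ρX(A)² = 0`.
-/
theorem ae_abs_le_of_ae_mul_le {ρX : Measure X} [SFinite ρX] {f : X → ℝ} (hκ : 0 ≤ κ)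
    (h : ∀ᵐ p ∂ρX.prod ρX, f p.1 * f p.2 ≤ κ ^ 2) : ∀ᵐ x ∂ρX, |f x| ≤ κ := by
  have key : ∀ A : Set X, (∀ x ∈ A, ∀ y ∈ A, κ ^ 2 < f x * f y) → ρX A = 0 := by
    intro A hA
    have h1 : (ρX.prod ρX) (A ×ˢ A) = 0 := by
      refine measure_mono_null (fun p hp => ?_) h
      exact not_le.2 (hA _ (Set.mem_prod.1 hp).1 _ (Set.mem_prod.1 hp).2)
    rw [Measure.prod_prod] at h1
    exact mul_self_eq_zero.1 h1
  have h1 : ∀ᵐ x ∂ρX, f x ≤ κ := by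
    have := key {x | κ < f x} fun x (hx : κ < f x) y (hy : κ < f y) => by nlinarith
    filter_upwards [measure_eq_zero_iff_ae_notMem.1 this] with x hx using not_lt.1 hx
  have h2 : ∀ᵐ x ∂ρX, -κ ≤ f x := by
    have := key {x | f x < -κ} fun x (hx : f x < -κ) y (hy : f y < -κ) => by nlinarith
    filter_upwards [measure_eq_zero_iff_ae_notMem.1 this] with x hx using not_lt.1 hx
  filter_upwards [h1, h2] with x hx1 hx2 using abs_le.2 ⟨hx2, hx1⟩

theorem BoundedFeatures.ae_eq_clip {ρX : Measure X} [SFinite ρX] {K : X → X → ℝ} (hκ : 0 ≤ κ)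
    (hφ : Measurable (Function.uncurry φ)) (hb : BoundedFeatures ρX μ φ K κ) :
    ∀ᵐ q ∂μ.prod ρX, φ q.1 q.2 = clip κ φ q.1 q.2 := by
  have hs : MeasurableSet {q : V × X | φ q.1 q.2 = clip κ φ q.1 q.2} :=
    measurableSet_eq_fun hφ (measurable_clip hφ)
  refine (Measure.ae_prod_iff_ae_ae hs).2 ?_
  filter_upwards [Measure.ae_ae_of_ae_prod hb.feature_mul_le] with v hv
  filter_upwards [ae_abs_le_of_ae_mul_le hκ hv] with x hx
  rw [abs_le] at hx
  rw [clip, min_eq_right hx.2, max_eq_right hx.1]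

theorem IsFeatureKernel.ae_kernel_eq [SFinite μ] {ρX : Measure X} [SFinite ρX] {K : X → X → ℝ}
    (h : IsFeatureKernel ρX μ φ K) (hφ : ∀ᵐ q ∂μ.prod ρX, φ q.1 q.2 = φ' q.1 q.2) :
    ∀ᵐ p ∂ρX.prod ρX, K p.1 p.2 = ∫ v, φ' v p.1 * φ' v p.2 ∂μ := by
  have h1 : ∀ᵐ q ∂ρX.prod μ, φ q.2 q.1 = φ' q.2 q.1 :=
    (Measure.measurePreserving_swap (μ := ρX) (ν := μ)).quasiMeasurePreserving.ae hφ
  have h2 := Measure.ae_ae_of_ae_prod h1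
  filter_upwards [Measure.quasiMeasurePreserving_fst.ae h2,
    Measure.quasiMeasurePreserving_snd.ae h2] with p hp1 hp2
  rw [h.kernel_eq]
  refine integral_congr_ae ?_
  filter_upwards [hp1, hp2] with v hv1 hv2
  rw [hv1, hv2]

end Congr

/-! ### Sums of powers -/

section Sums

open Finset

theorem sum_Ioc_inv_le (t : ℕ) : ∑ j ∈ Ioc 0 t, ((j : ℝ))⁻¹ ≤ 1 + Real.log t := by
  have h := harmonic_le_one_add_log t
  rw [harmonic_eq_sum_Icc] at h
  push_cast at h
  exact h

theorem sum_Ioc_reflect (t : ℕ) (f : ℝ → ℝ) :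
    ∑ j ∈ Ioc 0 t, f ((t : ℝ) + 1 - j) = ∑ j ∈ Ioc 0 t, f j := by
  refine Finset.sum_nbij' (fun j => t + 1 - j) (fun j => t + 1 - j) ?_ ?_ ?_ ?_ ?_
  · intro j hj; rw [mem_Ioc] at hj ⊢; omega
  · intro j hj; rw [mem_Ioc] at hj ⊢; omega
  · intro j hj; rw [mem_Ioc] at hj; omega
  · intro j hj; rw [mem_Ioc] at hj; omega
  · intro j hj
    rw [mem_Ioc] at hj
    rw [Nat.cast_sub (by omega)]
    push_cast
    rfl

theorem sum_Ioc_rpow_le {γ : ℝ} (hγ : 0 ≤ γ) (t : ℕ) :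
    ∑ j ∈ Ioc 0 t, ((t : ℝ) + 1 - j) ^ (γ - 1) ≤ (t : ℝ) ^ γ * (1 + Real.log t) := by
  rw [sum_Ioc_reflect t fun x => x ^ (γ - 1)]
  refine le_trans ?_ (mul_le_mul_of_nonneg_left (sum_Ioc_inv_le t) (by positivity))
  rw [mul_sum]
  refine sum_le_sum fun j hj => ?_
  rw [mem_Ioc] at hj
  have hj0 : (0 : ℝ) < j := by exact_mod_cast hj.1
  rw [Real.rpow_sub_one hj0.ne', div_eq_mul_inv]
  gcongr
  exact hj.2

/-- Up to the factors `j^(1-q)` and `(N - j)^γ`, bounded by their extremes, the term is `1 / (j (N -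
j))`. Partial fractions give two harmonic sums divided by `N`. -/
theorem sum_Ioc_rpow_mul_rpow_le {γ q : ℝ} (hγ : 0 ≤ γ) (t : ℕ) :
    ∑ j ∈ Ioc 0 t, (j : ℝ) ^ (-q) * ((t : ℝ) + 1 - j) ^ (γ - 1) ≤
      max 1 (((t : ℝ) + 1) ^ (1 - q)) * ((t : ℝ) + 1) ^ (γ - 1)
        * (2 * (1 + Real.log ((t : ℝ) + 1))) := by
  set N : ℝ := (t : ℝ) + 1 with hN
  have hN0 : 0 < N := by positivity
  set M : ℝ := max 1 (N ^ (1 - q)) with hM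
  have hM0 : 0 ≤ M := zero_le_one.trans (le_max_left _ _)
  have hterm : ∀ j ∈ Ioc 0 t, (j : ℝ) ^ (-q) * (N - j) ^ (γ - 1) ≤
      M * N ^ (γ - 1) * ((j : ℝ)⁻¹ + (N - j)⁻¹) := by
    intro j hj
    rw [mem_Ioc] at hj
    have hj1 : (1 : ℝ) ≤ j := by exact_mod_cast hj.1
    have hjt : (j : ℝ) ≤ t := by exact_mod_cast hj.2
    have hj0 : (0 : ℝ) < j := by linarith
    have hNj : 0 < N - j := by rw [hN]; linarith
    have h1 : (j : ℝ) ^ (-q) ≤ M * (j : ℝ)⁻¹ := by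
      have e : (j : ℝ) ^ (-q) = (j : ℝ) ^ (1 - q) * (j : ℝ)⁻¹ := by
        rw [show -q = (1 - q) - 1 by ring, Real.rpow_sub_one hj0.ne', div_eq_mul_inv]
      rw [e]
      refine mul_le_mul_of_nonneg_right ?_ (by positivity)
      rcases le_total 0 (1 - q) with hq | hq
      · exact (Real.rpow_le_rpow hj0.le (by linarith) hq).trans (le_max_right _ _)
      · exact (Real.rpow_le_one_of_one_le_of_nonpos hj1 hq).trans (le_max_left _ _)
    have h2 : (N - j) ^ (γ - 1) ≤ N ^ γ * (N - j)⁻¹ := by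
      rw [Real.rpow_sub_one hNj.ne', div_eq_mul_inv]
      refine mul_le_mul_of_nonneg_right ?_ (by positivity)
      exact Real.rpow_le_rpow hNj.le (by linarith) hγ
    calc _ ≤ (M * (j : ℝ)⁻¹) * (N ^ γ * (N - j)⁻¹) := by gcongr
      _ = M * N ^ (γ - 1) * ((j : ℝ)⁻¹ + (N - j)⁻¹) := by
        rw [Real.rpow_sub_one hN0.ne']
        field_simp
        ring
  refine (sum_le_sum hterm).trans ?_
  rw [← mul_sum, sum_add_distrib, hN, sum_Ioc_reflect t fun x => x⁻¹, ← hN]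
  have h3 := sum_Ioc_inv_le t
  have h4 : Real.log t ≤ Real.log N := by
    rcases Nat.eq_zero_or_pos t with rfl | ht
    · simp [hN]
    · exact Real.log_le_log (by exact_mod_cast ht) (by linarith)
  refine mul_le_mul_of_nonneg_left ?_ (by positivity)
  linarith

theorem tendsto_one_add_log_mul_rpow {a : ℝ} (ha : a < 0) :
    Filter.Tendsto (fun x : ℝ => (1 + Real.log x) * x ^ a) Filter.atTop (nhds 0) := by
  have h1 : Filter.Tendsto (fun x : ℝ => x ^ a) Filter.atTop (nhds 0) := by
    simpa using tendsto_rpow_neg_atTop (neg_pos.2 ha)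
  have h2 : Filter.Tendsto (fun x : ℝ => Real.log x * x ^ a) Filter.atTop (nhds 0) := by
    have h := (isLittleO_log_rpow_atTop (neg_pos.2 ha)).tendsto_div_nhds_zero
    refine h.congr' ?_
    filter_upwards [Filter.eventually_gt_atTop 0] with x hx
    rw [Real.rpow_neg hx.le, div_inv_eq_mul]
  have h3 := h1.add h2
  rw [add_zero] at h3
  exact h3.congr fun x => by ring

/-- Expanding the maximum leaves two expressions `(1 + log x) x^a`, whose exponents are the two
assumed negative; this avoids a case split on the sign of `1 - 2θ`. -/
theorem tendsto_weight {γ θ : ℝ} (h1 : (θ - 1) * (1 - γ) < 0) (h2 : γ - θ - θ * γ < 0) :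
    Filter.Tendsto (fun x : ℝ => x ^ (θ * (1 - γ)) * (max 1 (x ^ (1 - 2 * θ)) * x ^ (γ - 1)
      * (2 * (1 + Real.log x)))) Filter.atTop (nhds 0) := by
  have h := (((tendsto_one_add_log_mul_rpow h1).max
    (tendsto_one_add_log_mul_rpow h2)).const_mul 2)
  rw [max_self, mul_zero] at h
  refine h.congr' ?_
  filter_upwards [Filter.eventually_ge_atTop 1] with x hx
  have hx0 : 0 < x := by linarith
  have hl : 0 ≤ 1 + Real.log x := by linarith [Real.log_nonneg hx]
  have e1 : x ^ ((θ - 1) * (1 - γ)) = x ^ (θ * (1 - γ)) * x ^ (γ - 1) := by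
    rw [← Real.rpow_add hx0]; congr 1; ring
  have e2 : x ^ (γ - θ - θ * γ) = x ^ (θ * (1 - γ)) * x ^ (γ - 1) * x ^ (1 - 2 * θ) := by
    rw [← Real.rpow_add hx0, ← Real.rpow_add hx0]; congr 1; ring
  rw [e2, ← mul_max_of_nonneg _ _ hl, e1]
  have e3 : max (x ^ (θ * (1 - γ)) * x ^ (γ - 1))
      (x ^ (θ * (1 - γ)) * x ^ (γ - 1) * x ^ (1 - 2 * θ)) =
      x ^ (θ * (1 - γ)) * x ^ (γ - 1) * max 1 (x ^ (1 - 2 * θ)) := by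
    rw [mul_max_of_nonneg _ _ (by positivity), mul_one]
  rw [e3]
  ring

/-- One term of the exponential series with `n β > 2` suffices. The power `-2` is chosen so that `T`
such terms still sum to `T⁻¹`. -/
theorem exp_neg_mul_rpow_le {b β : ℝ} (hb : 0 < b) (hβ : 0 < β) :
    ∃ C : ℝ, 0 < C ∧ ∀ x : ℝ, 1 ≤ x → Real.exp (-(b * x ^ β)) ≤ C * x ^ (-2 : ℝ) := by
  obtain ⟨n, hn⟩ := exists_nat_gt (2 / β)
  refine ⟨n.factorial / b ^ n, by positivity, fun x hx => ?_⟩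
  have hx0 : 0 < x := by linarith
  have h := Real.pow_div_factorial_le_exp (b * x ^ β) (by positivity) n
  have h1 : Real.exp (-(b * x ^ β)) ≤ n.factorial / (b * x ^ β) ^ n := by
    rw [Real.exp_neg, inv_le_comm₀ (Real.exp_pos _) (by positivity), inv_div]
    exact h
  refine h1.trans ?_
  rw [mul_pow, ← div_div, div_eq_mul_inv (_ / _)]
  refine mul_le_mul_of_nonneg_left ?_ (by positivity)
  rw [← Real.rpow_mul_natCast hx0.le, ← Real.rpow_neg hx0.le]
  refine Real.rpow_le_rpow_of_exponent_le hx ?_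
  rw [div_lt_iff₀ hβ] at hn
  linarith

/-- A discrete Volterra inequality whose weights have sums tending to `0` has bounded solutions,
with a bound depending on the weights only through the bound on their sums. -/
theorem exists_volterra_bound {A : ℝ} (hA : 0 < A) {ω : ℕ → ℝ}
    (hω : Filter.Tendsto ω Filter.atTop (nhds 0)) :
    ∃ D : ℝ, 0 < D ∧ ∀ (m : ℕ → ℝ≥0∞) (w : ℕ → ℕ → ℝ), (∀ j t, j ≤ t → 0 ≤ w j t) →
      (∀ t, ∑ j ∈ Ioc 0 t, w j t ≤ ω t) →
      (∀ t, m t ≤ ENNReal.ofReal A + ∑ j ∈ Ioc 0 t, ENNReal.ofReal (w j t) * m (j - 1)) →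
      ∀ t, m t ≤ ENNReal.ofReal D := by
  obtain ⟨W, hW⟩ := hω.bddAbove_range
  obtain ⟨t₀, ht₀⟩ := Filter.eventually_atTop.1
    (hω.eventually_le_const (by norm_num : (0 : ℝ) < 1 / 2))
  set Q : ℝ := 1 + |W| with hQ
  have hQ1 : 1 ≤ Q := by rw [hQ]; linarith [abs_nonneg W]
  -- Before `t₀` the bound may grow by `Q = 1 + |W|` per step; afterwards the weights sum to at most
  -- `1/2`, and `A + b/2 ≤ b` because `b ≥ 2A`. Only `A` and the bound `ω` enter.
  set b : ℕ → ℝ := fun t => 2 * A * Q ^ min t t₀ with hb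
  have hbA : ∀ t, 2 * A ≤ b t := fun t => le_mul_of_one_le_right (by positivity) (one_le_pow₀ hQ1)
  have hbm : Monotone b := fun s t hst => by
    simp only [hb]
    gcongr
  refine ⟨2 * A * Q ^ t₀, by positivity, fun m w hw hwω hm t => ?_⟩
  have key : m t ≤ ENNReal.ofReal (b t) := by
    induction t using Nat.strong_induction_on with
    | _ t ih =>
      rcases t with _ | t
      · refine (hm 0).trans ?_
        simp only [Ioc_self, sum_empty, add_zero]
        exact ENNReal.ofReal_le_ofReal (by linarith [hbA 0])
      · refine (hm (t + 1)).trans ?_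
        have h1 : ∑ j ∈ Ioc 0 (t + 1), ENNReal.ofReal (w j (t + 1)) * m (j - 1) ≤
            ENNReal.ofReal (ω (t + 1) * b t) := by
          calc _ ≤ ∑ j ∈ Ioc 0 (t + 1), ENNReal.ofReal (w j (t + 1)) * ENNReal.ofReal (b t) := by
                refine sum_le_sum fun j hj => mul_le_mul_right ?_ _
                rw [mem_Ioc] at hj
                exact (ih (j - 1) (by omega)).trans (ENNReal.ofReal_le_ofReal (hbm (by omega)))
            _ = ENNReal.ofReal ((∑ j ∈ Ioc 0 (t + 1), w j (t + 1)) * b t) := by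
                rw [← sum_mul, ← ENNReal.ofReal_sum_of_nonneg
                    fun j hj => hw j (t + 1) (mem_Ioc.1 hj).2,
                  ENNReal.ofReal_mul (sum_nonneg fun j hj => hw j (t + 1) (mem_Ioc.1 hj).2)]
            _ ≤ _ := ENNReal.ofReal_le_ofReal
                (mul_le_mul_of_nonneg_right (hwω _) (by linarith [hbA t]))
        have h0 : 0 ≤ ω (t + 1) :=
          (sum_nonneg fun j hj => hw j (t + 1) (mem_Ioc.1 hj).2).trans (hwω _)
        have hbt := hbA t
        refine (add_le_add le_rfl h1).trans ?_
        rw [← ENNReal.ofReal_add hA.le (mul_nonneg h0 (by linarith))]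
        refine ENNReal.ofReal_le_ofReal ?_
        rcases lt_or_ge t t₀ with h | h
        · have e : b (t + 1) = b t * Q := by
            simp only [hb]
            rw [min_eq_left (by omega), min_eq_left (by omega), pow_succ]
            ring
          have h2 : ω (t + 1) ≤ |W| := (hW ⟨t + 1, rfl⟩).trans (le_abs_self W)
          have h3 : ω (t + 1) * b t ≤ |W| * b t := mul_le_mul_of_nonneg_right h2 (by linarith)
          rw [e, hQ]
          linarith
        · have h2 : ω (t + 1) ≤ 1 / 2 := ht₀ _ (by omega)
          have h3 : ω (t + 1) * b t ≤ 1 / 2 * b t := mul_le_mul_of_nonneg_right h2 (by linarith)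
          have h4 : b t ≤ b (t + 1) := hbm (by omega)
          linarith
  refine key.trans (ENNReal.ofReal_le_ofReal ?_)
  simp only [hb]
  gcongr
  exact min_le_right _ _

end Sums

/-! ### Polynomially decaying step sizes -/

section StepSizes

variable {η₀ θ γ : ℝ}

theorem le_sum_stepSize (hη : 0 ≤ η₀) (hθ : 0 ≤ θ) (j t : ℕ) (hjt : j ≤ t) :
    ((t : ℝ) - j) * (η₀ * (t : ℝ) ^ (-θ)) ≤ ∑ i ∈ Finset.Ioc j t, η₀ * (i : ℝ) ^ (-θ) := by
  have h := Finset.card_nsmul_le_sum (Finset.Ioc j t) (fun i : ℕ => η₀ * (i : ℝ) ^ (-θ))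
    (η₀ * (t : ℝ) ^ (-θ)) fun i hi => by
      rw [Finset.mem_Ioc] at hi
      refine mul_le_mul_of_nonneg_left ?_ hη
      exact Real.rpow_le_rpow_of_nonpos (by exact_mod_cast (by omega : 0 < i))
        (by exact_mod_cast hi.2) (by linarith)
  rw [Nat.card_Ioc, nsmul_eq_mul, Nat.cast_sub hjt] at h
  exact h

/-- The `t - j` steps are each at least the last one, and `γ - 1 < 0` reverses the inequality.
Replacing `t - j` by `(t + 1 - j) / 2` costs the factor `2` and gives an expression that remains
usable at `j = t`. -/
theorem rpow_sum_stepSize_le (hη : 0 < η₀) (hθ : 0 ≤ θ) (hγ0 : 0 ≤ γ) (hγ1 : γ < 1) {j t : ℕ}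
    (hjt : j < t) :
    (∑ i ∈ Finset.Ioc j t, η₀ * (i : ℝ) ^ (-θ)) ^ (γ - 1) ≤
      2 * η₀ ^ (γ - 1) * (((t : ℝ) + 1 - j) ^ (γ - 1) * (t : ℝ) ^ (θ * (1 - γ))) := by
  have hjt' : (j : ℝ) + 1 ≤ t := by exact_mod_cast hjt
  have ht0 : (0 : ℝ) < t := by linarith [Nat.cast_nonneg (α := ℝ) j]
  have h1 := le_sum_stepSize hη.le hθ j t hjt.le
  have h2 : ((t : ℝ) + 1 - j) / 2 * (η₀ * (t : ℝ) ^ (-θ)) ≤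
      ((t : ℝ) - j) * (η₀ * (t : ℝ) ^ (-θ)) :=
    mul_le_mul_of_nonneg_right (by linarith) (by positivity)
  have h3 : 0 < ((t : ℝ) + 1 - j) := by linarith
  have h4 : 0 < ((t : ℝ) + 1 - j) / 2 := by linarith
  refine (Real.rpow_le_rpow_of_nonpos (by positivity) (h2.trans h1) (by linarith)).trans ?_
  rw [Real.mul_rpow h4.le (by positivity), Real.mul_rpow hη.le (by positivity),
    ← Real.rpow_mul ht0.le, Real.div_rpow h3.le (by norm_num)]
  have e : -θ * (γ - 1) = θ * (1 - γ) := by ring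
  have h5 : ((2 : ℝ) ^ (γ - 1))⁻¹ ≤ 2 := by
    rw [← Real.rpow_neg (by norm_num)]
    refine (Real.rpow_le_rpow_of_exponent_le (by norm_num) (by linarith : -(γ - 1) ≤ 1)).trans ?_
    norm_num
  rw [e, div_eq_mul_inv]
  calc _ = ((2 : ℝ) ^ (γ - 1))⁻¹ * (η₀ ^ (γ - 1) *
        (((t : ℝ) + 1 - j) ^ (γ - 1) * (t : ℝ) ^ (θ * (1 - γ)))) := by ring
    _ ≤ 2 * (η₀ ^ (γ - 1) * (((t : ℝ) + 1 - j) ^ (γ - 1) * (t : ℝ) ^ (θ * (1 - γ)))) :=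
        mul_le_mul_of_nonneg_right h5 (by positivity)
    _ = _ := by ring

end StepSizes

/-! ### Weights of the variance terms -/

section Weight

variable {κ c γ θ η₀ : ℝ}

/-- The bound on the sums of the weights in the Volterra inequality for the risks. -/
def volterraWeight (κ c γ θ η₀ x : ℝ) : ℝ :=
  4 * κ ^ 2 * η₀ ^ 2 * (κ ^ 2 + 2 * c * η₀ ^ (γ - 1)) *
    (x ^ (θ * (1 - γ)) * (max 1 (x ^ (1 - 2 * θ)) * x ^ (γ - 1) * (2 * (1 + Real.log x))))

theorem sum_weight_le (hη₀ : 0 < η₀) (hθ : 0 ≤ θ) (hγ0 : 0 ≤ γ) (hγ1 : γ < 1)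
    (hc : 0 ≤ c) (t : ℕ) :
    ∑ j ∈ Finset.Ioc 0 t, 4 * ((η₀ * (j : ℝ) ^ (-θ)) ^ 2 * κ ^ 2)
        * ((κ ^ 2 + 2 * c * η₀ ^ (γ - 1)) *
          (((t : ℝ) + 1 - j) ^ (γ - 1) * (t : ℝ) ^ (θ * (1 - γ)))) ≤
      volterraWeight κ c γ θ η₀ ((t + 1 : ℕ) : ℝ) := by
  have h1 := sum_Ioc_rpow_mul_rpow_le (q := 2 * θ) hγ0 t
  have e : ∀ j : ℕ, 4 * ((η₀ * (j : ℝ) ^ (-θ)) ^ 2 * κ ^ 2)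
        * ((κ ^ 2 + 2 * c * η₀ ^ (γ - 1)) *
          (((t : ℝ) + 1 - j) ^ (γ - 1) * (t : ℝ) ^ (θ * (1 - γ)))) =
      (4 * κ ^ 2 * η₀ ^ 2 * (κ ^ 2 + 2 * c * η₀ ^ (γ - 1)) * (t : ℝ) ^ (θ * (1 - γ)))
        * ((j : ℝ) ^ (-(2 * θ)) * ((t : ℝ) + 1 - j) ^ (γ - 1)) := fun j => by
    have : (j : ℝ) ^ (-(2 * θ)) = ((j : ℝ) ^ (-θ)) ^ 2 := by
      rw [← Real.rpow_mul_natCast (Nat.cast_nonneg j)]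
      congr 1
      push_cast
      ring
    rw [this]
    ring
  simp_rw [e]
  rw [← Finset.mul_sum]
  refine (mul_le_mul_of_nonneg_left h1 (by positivity)).trans ?_
  rw [volterraWeight]
  push_cast
  have h2 : (t : ℝ) ^ (θ * (1 - γ)) ≤ ((t : ℝ) + 1) ^ (θ * (1 - γ)) :=
    Real.rpow_le_rpow (Nat.cast_nonneg t) (by linarith) (mul_nonneg hθ (by linarith))
  have h3 : 0 ≤ Real.log ((t : ℝ) + 1) := Real.log_nonneg (by linarith [Nat.cast_nonneg (α := ℝ) t])
  have h4 : (0 : ℝ) ≤ max 1 (((t : ℝ) + 1) ^ (1 - 2 * θ)) := zero_le_one.trans (le_max_left _ _)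
  rw [mul_assoc]
  refine mul_le_mul_of_nonneg_left (mul_le_mul_of_nonneg_right h2 (by positivity)) (by positivity)

end Weight

/-! ### The learning model with bounded features -/

section Model

variable {X V : Type*} [MeasurableSpace X] [MeasurableSpace V]

/-- Features bounded by `κ` everywhere, their second moment operator `L`, and the class `h` of the
regression function. -/
structure IsModel (ρ : Measure (X × ℝ)) [IsFiniteMeasure ρ] (μ : Measure V) (φ : V → X → ℝ) (κ : ℝ)
    (L : Lp ℝ 2 ρ.fst →L[ℝ] Lp ℝ 2 ρ.fst) (h : Lp ℝ 2 ρ.fst) : Prop where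
  measurable : Measurable (Function.uncurry φ)
  abs_le : ∀ v x, |φ v x| ≤ κ
  pos : 0 < κ
  inner_eq : ∀ u w, inner ℝ u (L w) =
    ∫ v, inner ℝ u (toL2 ρ.fst (φ v)) * inner ℝ (toL2 ρ.fst (φ v)) w ∂μ
  coe_eq : h =ᵐ[ρ.fst] regressionFun ρ
  integrable_sq : Integrable (fun z : X × ℝ => z.2 ^ 2) ρ

variable {ρ : Measure (X × ℝ)} [IsProbabilityMeasure ρ] {μ : Measure V}
  {φ : V → X → ℝ} {κ : ℝ} {L : Lp ℝ 2 ρ.fst →L[ℝ] Lp ℝ 2 ρ.fst} {h p : Lp ℝ 2 ρ.fst}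
  {η : ℕ → ℝ} {lam η₀ θ γ c : ℝ}

theorem IsModel.isPositive (M : IsModel ρ μ φ κ L h) : L.IsPositive :=
  isPositive_of_inner_eq M.inner_eq

theorem IsModel.norm_feature_le (M : IsModel ρ μ φ κ L h) (v : V) : ‖toL2 ρ.fst (φ v)‖ ≤ κ :=
  norm_featureMap_le M.pos.le M.measurable M.abs_le v

variable [IsProbabilityMeasure μ] [StandardBorelSpace X]

theorem IsModel.inner_map_self_le (M : IsModel ρ μ φ κ L h) (u : Lp ℝ 2 ρ.fst) :
    inner ℝ (L u) u ≤ κ ^ 2 * ‖u‖ ^ 2 :=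
  DoublyStochastic.inner_map_self_le (stronglyMeasurable_featureMap M.measurable M.abs_le)
    M.norm_feature_le M.inner_eq u

theorem IsModel.norm_propagator_sq_le (M : IsModel ρ μ φ κ L h) (hη : ∀ j, 0 ≤ η j)
    (hηm : ∀ j, 1 ≤ j → η j * (κ ^ 2 + 2 * lam) ≤ 1) {j t : ℕ} (hjt : j ≤ t)
    (u : Lp ℝ 2 ρ.fst) :
    ‖propagator L lam η j t u‖ ^ 2 ≤
      Real.exp (-(2 * lam * ∑ i ∈ Finset.Ioc j t, η i)) * ‖u‖ ^ 2 := by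
  have hκ := M.pos
  have h1 := powForm_propagator_le_exp M.isPositive (m := κ ^ 2) (by positivity)
    M.inner_map_self_le hη hηm 0 hjt u
  rwa [powForm_zero, powForm_zero] at h1

theorem IsModel.featureTrace_le_exp (M : IsModel ρ μ φ κ L h) (hη : ∀ j, 0 ≤ η j)
    (hηm : ∀ j, 1 ≤ j → η j * (κ ^ 2 + 2 * lam) ≤ 1) {j t : ℕ} (hjt : j ≤ t) :
    featureTrace ρ.fst μ φ (propagator L lam η j t) ≤
      ENNReal.ofReal (κ ^ 2 * Real.exp (-(2 * lam * ∑ i ∈ Finset.Ioc j t, η i))) := by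
  have hle : ∀ v, ENNReal.ofReal (‖propagator L lam η j t (toL2 ρ.fst (φ v))‖ ^ 2) ≤
      ENNReal.ofReal (κ ^ 2 * Real.exp (-(2 * lam * ∑ i ∈ Finset.Ioc j t, η i))) := fun v => by
    refine ENNReal.ofReal_le_ofReal ((M.norm_propagator_sq_le hη hηm hjt _).trans ?_)
    rw [mul_comm]
    refine mul_le_mul_of_nonneg_right ?_ (Real.exp_nonneg _)
    exact pow_le_pow_left₀ (norm_nonneg _) (M.norm_feature_le v) 2
  refine (lintegral_mono hle).trans ?_
  simp

theorem IsModel.featureTrace_le_rpow (M : IsModel ρ μ φ κ L h) (hη₀ : 0 < η₀) (hθ : 0 ≤ θ)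
    (hγ0 : 0 ≤ γ) (hγ1 : γ < 1) (hc : 0 ≤ c) (hlam : 0 ≤ lam)
    (hηm : ∀ j : ℕ, 1 ≤ j → η₀ * (j : ℝ) ^ (-θ) * (κ ^ 2 + 2 * lam) ≤ 1)
    (hcap : ∀ s : ℝ, 0 < s → effectiveDim L s ≤ ENNReal.ofReal (c * s ^ (-γ)))
    {j t : ℕ} (hjt : j ≤ t) (ht : 1 ≤ t) :
    featureTrace ρ.fst μ φ (propagator L lam (fun i : ℕ => η₀ * (i : ℝ) ^ (-θ)) j t) ≤
      ENNReal.ofReal ((κ ^ 2 + 2 * c * η₀ ^ (γ - 1)) *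
        (((t : ℝ) + 1 - j) ^ (γ - 1) * (t : ℝ) ^ (θ * (1 - γ)))) := by
  have hη : ∀ i : ℕ, 0 ≤ η₀ * (i : ℝ) ^ (-θ) := fun i => by positivity
  have ht1 : (1 : ℝ) ≤ t := by exact_mod_cast ht
  have hκ := M.pos
  rcases hjt.eq_or_lt with rfl | hlt
  -- At `j = t` no step remains and the capacity bound is void; the trivial bound `κ²` applies,
  -- which explains the summand `κ²` in the constant.
  · refine (M.featureTrace_le_exp hη hηm le_rfl).trans (ENNReal.ofReal_le_ofReal ?_)
    have h1 : (1 : ℝ) ≤ (j : ℝ) ^ (θ * (1 - γ)) :=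
      Real.one_le_rpow ht1 (mul_nonneg hθ (by linarith))
    have h2 : 0 ≤ 2 * c * η₀ ^ (γ - 1) := by positivity
    simp only [Finset.Ioc_self, Finset.sum_empty, mul_zero, neg_zero, Real.exp_zero, mul_one,
      add_sub_cancel_left, Real.one_rpow, one_mul]
    nlinarith [sq_nonneg κ]
  · have h1 := le_sum_stepSize hη₀.le hθ j t hjt
    have hjt' : (j : ℝ) + 1 ≤ t := by exact_mod_cast hlt
    have hs0 : 0 < ∑ i ∈ Finset.Ioc j t, η₀ * (i : ℝ) ^ (-θ) := by
      refine lt_of_lt_of_le ?_ h1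
      have : (0 : ℝ) < (t : ℝ) - j := by linarith
      positivity
    refine (lintegral_norm_propagator_sq_le (stronglyMeasurable_featureMap M.measurable M.abs_le)
      (lintegral_inner_sq_eq (stronglyMeasurable_featureMap M.measurable M.abs_le)
        M.norm_feature_le M.inner_eq) M.isPositive (m := κ ^ 2) (by positivity)
      M.inner_map_self_le hη hlam hηm hjt hs0 rfl (hcap _ (inv_pos.2 hs0))).trans
      (ENNReal.ofReal_le_ofReal ?_)
    have h2 := mul_le_mul_of_nonneg_left (rpow_sum_stepSize_le hη₀ hθ hγ0 hγ1 hlt) hc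
    refine h2.trans ?_
    have h3 : 0 < (t : ℝ) + 1 - j := by linarith
    have h4 : 0 ≤ κ ^ 2 * (((t : ℝ) + 1 - j) ^ (γ - 1) * (t : ℝ) ^ (θ * (1 - γ))) := by positivity
    linarith

theorem IsModel.meanSqDist_le (M : IsModel ρ μ φ κ L h) (hp : L p + lam • p = L h) (t : ℕ) :
    meanSqDist ρ μ φ η lam p 1 t ≤ ENNReal.ofReal (‖propagator L lam η 0 t p‖ ^ 2)
      + ∑ j ∈ Finset.Ioc 0 t, ENNReal.ofReal (η j ^ 2 * κ ^ 2)
        * (meanRisk ρ μ φ η lam (j - 1) * featureTrace ρ.fst μ φ (propagator L lam η j t)) := by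
  have h1 := meanSqDist_le_sum (η := η) M.measurable M.abs_le M.pos.le M.inner_eq M.coe_eq
    M.integrable_sq hp 1 t
  simpa only [one_mul] using h1

/-- If the risks are bounded by `D` and the traces by `τ`, the error is bounded by the
bias plus the accumulated variances. -/
theorem IsModel.meanSqDist_le_ofReal (M : IsModel ρ μ φ κ L h) (hp : L p + lam • p = L h) {D : ℝ}
    (hD : 0 ≤ D) (hR : ∀ t, meanRisk ρ μ φ η lam t ≤ ENNReal.ofReal D) (t : ℕ) {τ : ℕ → ℝ}
    (hτ0 : ∀ j, j ≤ t → 0 ≤ τ j)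
    (hτ : ∀ j, j ≤ t → featureTrace ρ.fst μ φ (propagator L lam η j t) ≤ ENNReal.ofReal (τ j)) :
    meanSqDist ρ μ φ η lam p 1 t ≤ ENNReal.ofReal (‖propagator L lam η 0 t p‖ ^ 2
      + κ ^ 2 * D * ∑ j ∈ Finset.Ioc 0 t, η j ^ 2 * τ j) := by
  have hs : ∀ j ∈ Finset.Ioc 0 t, 0 ≤ η j ^ 2 * τ j := fun j hj =>
    mul_nonneg (sq_nonneg _) (hτ0 j (Finset.mem_Ioc.1 hj).2)
  refine (M.meanSqDist_le hp t).trans ?_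
  rw [ENNReal.ofReal_add (sq_nonneg _)
    (mul_nonneg (mul_nonneg (sq_nonneg _) hD) (Finset.sum_nonneg hs)), Finset.mul_sum,
    ENNReal.ofReal_sum_of_nonneg fun j hj =>
      mul_nonneg (mul_nonneg (sq_nonneg _) hD) (hs j hj)]
  refine add_le_add le_rfl (Finset.sum_le_sum fun j hj => ?_)
  have hj' := (Finset.mem_Ioc.1 hj).2
  calc _ ≤ ENNReal.ofReal (η j ^ 2 * κ ^ 2) * (ENNReal.ofReal D * ENNReal.ofReal (τ j)) := by
        gcongr
        · exact hR _
        · exact hτ j hj'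
    _ = _ := by
        rw [← ENNReal.ofReal_mul hD, ← ENNReal.ofReal_mul (by positivity)]
        congr 1
        ring

/-- The noise at each step is controlled by the current risk, so the error recursion closes into a
Volterra inequality for the risks. Only the capacity bound on the traces is used, so the weights do
not involve `lam`. -/
theorem IsModel.meanRisk_le_sum (M : IsModel ρ μ φ κ L h) (hη₀ : 0 < η₀) (hθ : 0 ≤ θ)
    (hγ0 : 0 ≤ γ) (hγ1 : γ < 1) (hc : 0 ≤ c) (hlam : 0 ≤ lam)
    (hηm : ∀ j : ℕ, 1 ≤ j → η₀ * (j : ℝ) ^ (-θ) * (κ ^ 2 + 2 * lam) ≤ 1)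
    (hcap : ∀ s : ℝ, 0 < s → effectiveDim L s ≤ ENNReal.ofReal (c * s ^ (-γ)))
    (hp : L p + lam • p = L h) {S : ℝ} (hS : risk ρ (regressionFun ρ) ≤ S) {A : ℝ}
    (hA : 4 * ‖p‖ ^ 2 + (4 * ‖p - h‖ ^ 2 + 2 * S) ≤ A) (t : ℕ) :
    meanRisk ρ μ φ (fun i : ℕ => η₀ * (i : ℝ) ^ (-θ)) lam t ≤ ENNReal.ofReal A
      + ∑ j ∈ Finset.Ioc 0 t, ENNReal.ofReal (4 * ((η₀ * (j : ℝ) ^ (-θ)) ^ 2 * κ ^ 2)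
        * ((κ ^ 2 + 2 * c * η₀ ^ (γ - 1)) *
          (((t : ℝ) + 1 - j) ^ (γ - 1) * (t : ℝ) ^ (θ * (1 - γ)))))
        * meanRisk ρ μ φ (fun i : ℕ => η₀ * (i : ℝ) ^ (-θ)) lam (j - 1) := by
  have hS0 : 0 ≤ S := (integral_nonneg fun z => sq_nonneg _).trans hS
  have hη : ∀ i : ℕ, 0 ≤ η₀ * (i : ℝ) ^ (-θ) := fun i => by positivity
  refine (meanRisk_le (p := p) M.measurable M.abs_le M.coe_eq M.integrable_sq hS t).trans ?_
  have hP : ‖propagator L lam (fun i : ℕ => η₀ * (i : ℝ) ^ (-θ)) 0 t p‖ ^ 2 ≤ ‖p‖ ^ 2 := by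
    refine (M.norm_propagator_sq_le hη hηm (Nat.zero_le t) p).trans ?_
    refine mul_le_of_le_one_left (sq_nonneg _) (Real.exp_le_one_iff.2 ?_)
    have := Finset.sum_nonneg fun i (_ : i ∈ Finset.Ioc 0 t) => hη i
    exact neg_nonpos.2 (by positivity)
  have h1 := (M.meanSqDist_le (η := fun i : ℕ => η₀ * (i : ℝ) ^ (-θ)) hp t).trans
    (add_le_add (ENNReal.ofReal_le_ofReal hP) le_rfl)
  refine (add_le_add (mul_le_mul_right h1 _) le_rfl).trans ?_
  rw [mul_add, add_right_comm, ← ENNReal.ofReal_mul (by norm_num),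
    ← ENNReal.ofReal_add (by positivity) (by positivity)]
  refine add_le_add (ENNReal.ofReal_le_ofReal hA) ?_
  rw [Finset.mul_sum]
  refine Finset.sum_le_sum fun j hj => ?_
  rw [Finset.mem_Ioc] at hj
  have h2 := M.featureTrace_le_rpow hη₀ hθ hγ0 hγ1 hc hlam hηm hcap hj.2 (by omega)
  have hjt : (j : ℝ) ≤ t := by exact_mod_cast hj.2
  calc _ ≤ ENNReal.ofReal 4 * (ENNReal.ofReal ((η₀ * (j : ℝ) ^ (-θ)) ^ 2 * κ ^ 2)
        * (meanRisk ρ μ φ (fun i : ℕ => η₀ * (i : ℝ) ^ (-θ)) lam (j - 1)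
          * ENNReal.ofReal ((κ ^ 2 + 2 * c * η₀ ^ (γ - 1)) *
            (((t : ℝ) + 1 - j) ^ (γ - 1) * (t : ℝ) ^ (θ * (1 - γ)))))) := by gcongr
    _ = _ := by
      rw [ENNReal.ofReal_mul (p := 4 * ((η₀ * (j : ℝ) ^ (-θ)) ^ 2 * κ ^ 2)) (by positivity),
        ENNReal.ofReal_mul (p := 4) (by norm_num)]
      ring

end Model

/-! ### The rate -/

section Rate

variable {η₀ θ γ α β κ C₁ Cₑ : ℝ}

/-- Early terms decay exponentially, late terms polynomially. -/
theorem sum_variance_le (hη₀ : 0 < η₀) (hθ0 : 0 ≤ θ) (hθ1 : θ ≤ 1) (hγ0 : 0 ≤ γ)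
    (hα : α = θ + θ * γ - γ) (hα1 : α ≤ 1) (hC₁ : 0 ≤ C₁) {T : ℕ} (hT : 1 ≤ T)
    (hCₑ : Real.exp (-(η₀ * (T : ℝ) ^ β)) ≤ Cₑ * (T : ℝ) ^ (-2 : ℝ)) {τ : ℕ → ℝ}
    (h1 : ∀ j, 2 * j < T → τ j ≤ κ ^ 2 * Real.exp (-(η₀ * (T : ℝ) ^ β)))
    (h2 : ∀ j, j ≤ T → T ≤ 2 * j →
      τ j ≤ C₁ * (((T : ℝ) + 1 - j) ^ (γ - 1) * (T : ℝ) ^ (θ * (1 - γ)))) :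
    ∑ j ∈ Finset.Ioc 0 T, (η₀ * (j : ℝ) ^ (-θ)) ^ 2 * τ j ≤
      η₀ ^ 2 * (κ ^ 2 * Cₑ + 4 * C₁) * ((T : ℝ) ^ (-α) * (1 + Real.log T)) := by
  have hT1 : (1 : ℝ) ≤ T := by exact_mod_cast hT
  have hT0 : (0 : ℝ) < T := by linarith
  have hlog : 0 ≤ Real.log T := Real.log_nonneg hT1
  have hterm : ∀ j ∈ Finset.Ioc 0 T, (η₀ * (j : ℝ) ^ (-θ)) ^ 2 * τ j ≤
      η₀ ^ 2 * κ ^ 2 * (Cₑ * (T : ℝ) ^ (-2 : ℝ))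
        + 4 * η₀ ^ 2 * C₁ * (T : ℝ) ^ (-2 * θ + θ * (1 - γ)) * ((T : ℝ) + 1 - j) ^ (γ - 1) := by
    intro j hj
    rw [Finset.mem_Ioc] at hj
    have hj1 : (1 : ℝ) ≤ j := by exact_mod_cast hj.1
    have hj0 : (0 : ℝ) < j := by linarith
    have hjT : (j : ℝ) ≤ T := by exact_mod_cast hj.2
    have hTj : 0 < (T : ℝ) + 1 - j := by linarith
    have hE : 0 ≤ η₀ ^ 2 * κ ^ 2 * (Cₑ * (T : ℝ) ^ (-2 : ℝ)) :=
      mul_nonneg (by positivity) ((Real.exp_nonneg _).trans hCₑ)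
    have hF : 0 ≤ 4 * η₀ ^ 2 * C₁ * (T : ℝ) ^ (-2 * θ + θ * (1 - γ))
        * ((T : ℝ) + 1 - j) ^ (γ - 1) := by positivity
    rcases lt_or_ge (2 * j) T with hlt | hge
    · have h3 : ((j : ℝ) ^ (-θ)) ^ 2 ≤ 1 :=
        pow_le_one₀ (by positivity) (Real.rpow_le_one_of_one_le_of_nonpos hj1 (by linarith))
      calc _ ≤ (η₀ * (j : ℝ) ^ (-θ)) ^ 2 * (κ ^ 2 * (Cₑ * (T : ℝ) ^ (-2 : ℝ))) := by
            refine mul_le_mul_of_nonneg_left ((h1 j hlt).trans ?_) (sq_nonneg _)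
            exact mul_le_mul_of_nonneg_left hCₑ (sq_nonneg _)
        _ = ((j : ℝ) ^ (-θ)) ^ 2 * (η₀ ^ 2 * κ ^ 2 * (Cₑ * (T : ℝ) ^ (-2 : ℝ))) := by ring
        _ ≤ η₀ ^ 2 * κ ^ 2 * (Cₑ * (T : ℝ) ^ (-2 : ℝ)) := mul_le_of_le_one_left hE h3
        _ ≤ _ := by linarith
    -- For `j ≥ T/2` the step size is at most twice the final one, since `2^θ ≤ 2`.
    · have h3 : (j : ℝ) ^ (-θ) ≤ 2 * (T : ℝ) ^ (-θ) := by
        have hge' : (T : ℝ) / 2 ≤ j := by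
          have : (T : ℝ) ≤ 2 * j := by exact_mod_cast hge
          linarith
        refine (Real.rpow_le_rpow_of_nonpos (by positivity) hge' (by linarith)).trans ?_
        rw [Real.div_rpow hT0.le (by norm_num), div_eq_mul_inv, mul_comm,
          ← Real.rpow_neg (by norm_num), neg_neg]
        refine mul_le_mul_of_nonneg_right ?_ (by positivity)
        exact (Real.rpow_le_rpow_of_exponent_le (by norm_num) hθ1).trans (by norm_num)
      have e : (T : ℝ) ^ (-2 * θ + θ * (1 - γ)) =
          ((T : ℝ) ^ (-θ)) ^ 2 * (T : ℝ) ^ (θ * (1 - γ)) := by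
        rw [Real.rpow_add hT0, ← Real.rpow_mul_natCast hT0.le]
        congr 2
        push_cast
        ring
      calc _ ≤ (η₀ * (j : ℝ) ^ (-θ)) ^ 2 *
            (C₁ * (((T : ℝ) + 1 - j) ^ (γ - 1) * (T : ℝ) ^ (θ * (1 - γ)))) :=
            mul_le_mul_of_nonneg_left (h2 j hj.2 hge) (sq_nonneg _)
        _ ≤ (η₀ * (2 * (T : ℝ) ^ (-θ))) ^ 2 *
            (C₁ * (((T : ℝ) + 1 - j) ^ (γ - 1) * (T : ℝ) ^ (θ * (1 - γ)))) := by gcongr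
        _ = 4 * η₀ ^ 2 * C₁ * (T : ℝ) ^ (-2 * θ + θ * (1 - γ))
            * ((T : ℝ) + 1 - j) ^ (γ - 1) := by rw [e]; ring
        _ ≤ _ := by linarith
  refine (Finset.sum_le_sum hterm).trans ?_
  rw [Finset.sum_add_distrib, Finset.sum_const, Nat.card_Ioc, Nat.sub_zero, nsmul_eq_mul,
    ← Finset.mul_sum]
  have hCe0 : 0 ≤ Cₑ := by
    have h : 0 ≤ Cₑ * (T : ℝ) ^ (-2 : ℝ) := (Real.exp_nonneg _).trans hCₑ
    exact nonneg_of_mul_nonneg_left h (by positivity)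
  have h3 : (T : ℝ) * (T : ℝ) ^ (-2 : ℝ) ≤ (T : ℝ) ^ (-α) := by
    nth_rewrite 1 [← Real.rpow_one (T : ℝ)]
    rw [← Real.rpow_add hT0]
    exact Real.rpow_le_rpow_of_exponent_le hT1 (by linarith)
  -- Exponent balance of the late terms: `-2θ` from the squared steps, `θ (1 - γ)` from the traces
  -- and `γ` from summation give `-α`.
  have h4 : (T : ℝ) ^ (-2 * θ + θ * (1 - γ)) * (T : ℝ) ^ γ = (T : ℝ) ^ (-α) := by
    rw [← Real.rpow_add hT0, hα]
    congr 1
    ring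
  have h5 := sum_Ioc_rpow_le hγ0 T
  have hTα : 0 < (T : ℝ) ^ (-α) := by positivity
  calc _ ≤ η₀ ^ 2 * κ ^ 2 * Cₑ * ((T : ℝ) * (T : ℝ) ^ (-2 : ℝ))
        + 4 * η₀ ^ 2 * C₁ * (T : ℝ) ^ (-2 * θ + θ * (1 - γ))
          * ((T : ℝ) ^ γ * (1 + Real.log T)) := by
        refine add_le_add (le_of_eq (by ring)) (mul_le_mul_of_nonneg_left h5 (by positivity))
    _ = η₀ ^ 2 * κ ^ 2 * Cₑ * ((T : ℝ) * (T : ℝ) ^ (-2 : ℝ))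
        + 4 * η₀ ^ 2 * C₁ * ((T : ℝ) ^ (-α) * (1 + Real.log T)) := by rw [← h4]; ring
    _ ≤ η₀ ^ 2 * κ ^ 2 * Cₑ * ((T : ℝ) ^ (-α) * (1 + Real.log T))
        + 4 * η₀ ^ 2 * C₁ * ((T : ℝ) ^ (-α) * (1 + Real.log T)) := by
        refine add_le_add (mul_le_mul_of_nonneg_left (h3.trans ?_) (by positivity)) le_rfl
        exact le_mul_of_one_le_right hTα.le (by linarith)
    _ = _ := by ring

end Rate

/-! ### The regularized approximation and the final bound -/

section Regularization

variable {H : Type*} [NormedAddCommGroup H] [InnerProductSpace ℝ H] [CompleteSpace H]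
  {L : H →L[ℝ] H} {lam : ℝ}

/-- The regularized approximation `(L + λ)⁻¹ L h`. -/
def regularized (L : H →L[ℝ] H) (lam : ℝ) (h : H) : H :=
  Ring.inverse (L + lam • (1 : H →L[ℝ] H)) (L h)

theorem map_regularized_add (hL : L.IsPositive) (hlam : 0 < lam) (h : H) :
    L (regularized L lam h) + lam • regularized L lam h = L h := by
  have e := DFunLike.congr_fun (Ring.mul_inverse_cancel _ (isUnit_add_smul_one hL hlam)) (L h)
  simpa [regularized] using e

theorem regularized_sub (hL : L.IsPositive) (hlam : 0 < lam) (h : H) :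
    regularized L lam h - h = -(lam • Ring.inverse (L + lam • (1 : H →L[ℝ] H)) h) := by
  have e := DFunLike.congr_fun (Ring.inverse_mul_cancel _ (isUnit_add_smul_one hL hlam)) h
  simp only [mul_apply_eq_comp, add_apply, smul_apply, one_apply_eq_self, map_add, map_smul] at e
  rw [regularized, sub_eq_iff_eq_add, ← sub_eq_neg_add, eq_sub_iff_add_eq]
  exact e

end Regularization

section Bound

variable {X V : Type*} [MeasurableSpace X] [MeasurableSpace V] [StandardBorelSpace X]
  {ρ : Measure (X × ℝ)} [IsProbabilityMeasure ρ] {μ : Measure V} [IsProbabilityMeasure μ]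
  {φ : V → X → ℝ} {κ : ℝ} {L : Lp ℝ 2 ρ.fst →L[ℝ] Lp ℝ 2 ρ.fst} {h p : Lp ℝ 2 ρ.fst}
  {lam η₀ θ γ c α β D Cₑ : ℝ}

/-- The bound on the distance to the regularized approximation after `T` steps. -/
theorem IsModel.meanSqDist_le_rate (M : IsModel ρ μ φ κ L h) (hη₀ : 0 < η₀) (hθ0 : 0 ≤ θ)
    (hθ1 : θ ≤ 1) (hγ0 : 0 ≤ γ) (hγ1 : γ < 1) (hc : 0 ≤ c) (hα : α = θ + θ * γ - γ) (hα1 : α ≤ 1)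
    {T : ℕ} (hT : 1 ≤ T) (hlam : lam = (T : ℝ) ^ (θ - 1 + β))
    (hηm : ∀ j : ℕ, 1 ≤ j → η₀ * (j : ℝ) ^ (-θ) * (κ ^ 2 + 2 * lam) ≤ 1)
    (hcap : ∀ s : ℝ, 0 < s → effectiveDim L s ≤ ENNReal.ofReal (c * s ^ (-γ)))
    (hp : L p + lam • p = L h) (hD : 0 ≤ D)
    (hR : ∀ t, meanRisk ρ μ φ (fun i : ℕ => η₀ * (i : ℝ) ^ (-θ)) lam t ≤ ENNReal.ofReal D)
    (hCₑ : Real.exp (-(η₀ * (T : ℝ) ^ β)) ≤ Cₑ * (T : ℝ) ^ (-2 : ℝ)) :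
    meanSqDist ρ μ φ (fun i : ℕ => η₀ * (i : ℝ) ^ (-θ)) lam p 1 T ≤
      ENNReal.ofReal ((Cₑ * ‖p‖ ^ 2
        + κ ^ 2 * D * (η₀ ^ 2 * (κ ^ 2 * Cₑ + 4 * (κ ^ 2 + 2 * c * η₀ ^ (γ - 1)))))
          * ((T : ℝ) ^ (-α) * (1 + Real.log T))) := by
  have hκ := M.pos
  have hT1 : (1 : ℝ) ≤ T := by exact_mod_cast hT
  have hT0 : (0 : ℝ) < T := by linarith
  have hlog : 0 ≤ Real.log T := Real.log_nonneg hT1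
  have hlam0 : 0 ≤ lam := by rw [hlam]; positivity
  set η : ℕ → ℝ := fun i => η₀ * (i : ℝ) ^ (-θ) with hηdef
  have hη : ∀ i, 0 ≤ η i := fun i => by simp only [hηdef]; positivity
  set E := Real.exp (-(η₀ * (T : ℝ) ^ β)) with hE
  -- At least `T/2` steps remain, each at least `η₀ T^(-θ)`; multiplied by `2 λ = 2 T^(θ - 1 + β)`
  -- this is `η₀ T^β`. The excess `β > 0` makes the factor smaller than any power of `T`.
  have hexp : ∀ j, 2 * j ≤ T → Real.exp (-(2 * lam * ∑ i ∈ Finset.Ioc j T, η i)) ≤ E := by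
    intro j hj
    refine Real.exp_le_exp.2 (neg_le_neg ?_)
    have h1 := le_sum_stepSize hη₀.le hθ0 j T (by omega)
    have hj' : 2 * (j : ℝ) ≤ T := by exact_mod_cast hj
    have h2 : (T : ℝ) / 2 * (η₀ * (T : ℝ) ^ (-θ)) ≤ ∑ i ∈ Finset.Ioc j T, η i :=
      (mul_le_mul_of_nonneg_right (by linarith) (by positivity)).trans h1
    have h3 : (T : ℝ) ^ (θ - 1 + β) * (T : ℝ) * (T : ℝ) ^ (-θ) = (T : ℝ) ^ β := by
      rw [← Real.rpow_add_one hT0.ne', ← Real.rpow_add hT0]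
      congr 1
      ring
    calc η₀ * (T : ℝ) ^ β = 2 * lam * ((T : ℝ) / 2 * (η₀ * (T : ℝ) ^ (-θ))) := by
          rw [← h3, hlam]; ring
      _ ≤ _ := mul_le_mul_of_nonneg_left h2 (by positivity)
  set C₁ := κ ^ 2 + 2 * c * η₀ ^ (γ - 1) with hC₁
  have hC₁0 : 0 ≤ C₁ := by positivity
  set τ : ℕ → ℝ := fun j => if 2 * j < T then κ ^ 2 * E else
    C₁ * (((T : ℝ) + 1 - j) ^ (γ - 1) * (T : ℝ) ^ (θ * (1 - γ))) with hτ
  have hτ0 : ∀ j, j ≤ T → 0 ≤ τ j := by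
    intro j hj
    have hj' : (j : ℝ) ≤ T := by exact_mod_cast hj
    have h1 : 0 ≤ (T : ℝ) + 1 - j := by linarith
    simp only [hτ]
    split_ifs
    · exact mul_nonneg (sq_nonneg _) (Real.exp_nonneg _)
    · positivity
  have hτ1 : ∀ j, j ≤ T → featureTrace ρ.fst μ φ (propagator L lam η j T) ≤
      ENNReal.ofReal (τ j) := by
    intro j hj
    simp only [hτ]
    split_ifs with hlt
    · refine (M.featureTrace_le_exp hη hηm hj).trans (ENNReal.ofReal_le_ofReal ?_)
      exact mul_le_mul_of_nonneg_left (hexp j hlt.le) (sq_nonneg _)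
    · exact M.featureTrace_le_rpow hη₀ hθ0 hγ0 hγ1 hc hlam0 hηm hcap hj hT
  refine (M.meanSqDist_le_ofReal hp hD hR T hτ0 hτ1).trans (ENNReal.ofReal_le_ofReal ?_)
  have hsum := sum_variance_le (κ := κ) hη₀ hθ0 hθ1 hγ0 hα hα1 hC₁0 hT hCₑ (τ := τ)
    (fun j hj => by simp only [hτ, if_pos hj]; exact le_rfl)
    (fun j _ hj => by simp only [hτ, if_neg (not_lt.2 hj)]; exact le_rfl)
  have hCe0 : 0 ≤ Cₑ := by
    have h : 0 ≤ Cₑ * (T : ℝ) ^ (-2 : ℝ) := (Real.exp_nonneg _).trans hCₑ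
    exact nonneg_of_mul_nonneg_left h (by positivity)
  have hbias : ‖propagator L lam η 0 T p‖ ^ 2 ≤
      Cₑ * ‖p‖ ^ 2 * ((T : ℝ) ^ (-α) * (1 + Real.log T)) := by
    refine (M.norm_propagator_sq_le hη hηm (Nat.zero_le T) p).trans ?_
    have h1 : (T : ℝ) ^ (-2 : ℝ) ≤ (T : ℝ) ^ (-α) * (1 + Real.log T) :=
      (Real.rpow_le_rpow_of_exponent_le hT1 (by linarith)).trans
        (le_mul_of_one_le_right (by positivity) (by linarith))
    calc _ ≤ Cₑ * (T : ℝ) ^ (-2 : ℝ) * ‖p‖ ^ 2 :=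
          mul_le_mul_of_nonneg_right ((hexp 0 (by omega)).trans hCₑ) (sq_nonneg _)
      _ ≤ Cₑ * ((T : ℝ) ^ (-α) * (1 + Real.log T)) * ‖p‖ ^ 2 := by gcongr
      _ = _ := by ring
  have h2 := mul_le_mul_of_nonneg_left hsum (mul_nonneg (sq_nonneg κ) hD)
  linarith

end Bound

end DoublyStochastic

end

/-! ### The main theorem: uniform constants and assembly. -/

theorem mainTheorem8
    (γ c ζ R κ ε S : ℝ)
    (hγ0 : 0 ≤ γ) (hγ1 : γ < 1) (hc : 0 < c) (hζ0 : 0 < ζ) (hζ1 : ζ ≤ 1) (hR : 0 < R) (hκ : 1 ≤ κ)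
    (hε0 : 0 < ε) (hε1 : ε ≤ 2 * ζ / (2 * ζ + γ + 1)) :
    ∃ C : ℝ, 0 < C ∧
      ∀ (X : Type*) [MeasurableSpace X] [StandardBorelSpace X]
        (V : Type*) [MeasurableSpace V]
        (ρ : MeasureTheory.Measure (X × ℝ)) [MeasureTheory.IsProbabilityMeasure ρ]
        (μ : MeasureTheory.Measure V) [MeasureTheory.IsProbabilityMeasure μ]
        (φ : V → X → ℝ) (K : X → X → ℝ),
        MeasureTheory.Integrable (fun z : X × ℝ => z.2 ^ 2) ρ →
        DoublyStochastic.IsFeatureKernel ρ.fst μ φ K →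
        DoublyStochastic.BoundedFeatures ρ.fst μ φ K κ →
        DoublyStochastic.SourceCondition ρ.fst K ζ R (DoublyStochastic.regressionFun ρ) →
        DoublyStochastic.CapacityCondition ρ.fst K γ c →
        DoublyStochastic.risk ρ (DoublyStochastic.regressionFun ρ) ≤ S →
        ∀ T : ℕ, 2 ≤ T →
          ∫⁻ s : Fin T → (X × ℝ) × V,
              DoublyStochastic.sqDist ρ.fst
                (DoublyStochastic.iterate φ
                  (fun t : ℕ => ζ / (3 * κ ^ 2 * (3 * c + κ ^ 2) * (1 + ζ))
                    * (t : ℝ) ^ (-((2 * ζ + γ) / (2 * ζ + γ + 1))))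
                  ((T : ℝ) ^ (-(1 / (2 * ζ + γ + 1)) + ε / (2 * ζ)))
                  T s)
                (DoublyStochastic.regressionFun ρ)
            ∂(MeasureTheory.Measure.pi fun _ : Fin T => ρ.prod μ)
          ≤ ENNReal.ofReal
              (C * (T : ℝ) ^ (-(2 * ζ / (2 * ζ + γ + 1)) + ε) * Real.log T) := by
  open DoublyStochastic in
  have hκ0 : 0 < κ := by linarith
  have hκ2 : 1 ≤ κ ^ 2 := one_le_pow₀ hκ
  have hd : 0 < 2 * ζ + γ + 1 := by positivity
  set η₀ : ℝ := ζ / (3 * κ ^ 2 * (3 * c + κ ^ 2) * (1 + ζ)) with hη₀def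
  have hη₀ : 0 < η₀ := by positivity
  set θ : ℝ := (2 * ζ + γ) / (2 * ζ + γ + 1) with hθdef
  have hθ0 : 0 < θ := by positivity
  have hθ1 : θ < 1 := by rw [hθdef, div_lt_one hd]; linarith
  set α : ℝ := 2 * ζ / (2 * ζ + γ + 1) with hαdef
  have hα : α = θ + θ * γ - γ := by
    rw [hαdef, hθdef]
    field_simp
    ring
  have hα0 : 0 < α := by positivity
  have hα1 : α ≤ 1 := by rw [hαdef, div_le_one hd]; linarith
  set β : ℝ := ε / (2 * ζ) with hβdef
  have hβ0 : 0 < β := by positivity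
  have hlamexp : -(1 / (2 * ζ + γ + 1)) = θ - 1 := by
    rw [hθdef]
    field_simp
    ring
  -- The upper bound on `ε` is exactly the condition `λ ≤ 1`.
  have hβθ : θ - 1 + β ≤ 0 := by
    have h1 : β ≤ 1 / (2 * ζ + γ + 1) := by
      rw [hβdef, div_le_iff₀ (by positivity)]
      calc ε ≤ _ := hε1
        _ = _ := by rw [hαdef]; ring
    linarith
  have hαβ : (θ - 1 + β) * (2 * ζ) = -α + ε := by
    rw [hαdef, hθdef, hβdef]
    field_simp
    ring
  -- With `m = κ²` and `λ ≤ 1`, this yields the step-size condition for every `j ≥ 1`.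
  have hstep : η₀ * (κ ^ 2 + 2) ≤ 1 := by
    have h1 : 0 < 3 * κ ^ 2 * (3 * c + κ ^ 2) * (1 + ζ) := by positivity
    rw [hη₀def, div_mul_eq_mul_div, div_le_one h1]
    have h2 : κ ^ 2 + 2 ≤ 3 * κ ^ 2 := by linarith
    have h3 : 1 ≤ 3 * c + κ ^ 2 := by linarith
    calc ζ * (κ ^ 2 + 2) ≤ (1 + ζ) * (3 * κ ^ 2) :=
          mul_le_mul (by linarith) h2 (by positivity) (by positivity)
      _ ≤ (1 + ζ) * (3 * κ ^ 2) * (3 * c + κ ^ 2) := le_mul_of_one_le_right (by positivity) h3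
      _ = _ := by ring
  have hω : Filter.Tendsto (fun t : ℕ => volterraWeight κ c γ θ η₀ ((t + 1 : ℕ) : ℝ))
      Filter.atTop (nhds 0) := by
    have h1 := (tendsto_weight (γ := γ) (θ := θ) (mul_neg_of_neg_of_pos (by linarith) (by linarith))
      (by linarith)).const_mul (4 * κ ^ 2 * η₀ ^ 2 * (κ ^ 2 + 2 * c * η₀ ^ (γ - 1)))
    rw [mul_zero] at h1
    exact h1.comp (tendsto_natCast_atTop_atTop.comp (Filter.tendsto_add_atTop_nat 1))
  -- `A` anticipates `‖p‖ ≤ κ² R + R` and `‖p - h‖ ≤ R`. The absolute value keeps it positive for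
  -- every real `S`, before any measure is introduced.
  set A : ℝ := 4 * (κ ^ 2 * R + R) ^ 2 + (4 * R ^ 2 + 2 * |S|) with hAdef
  have hA : 0 < A := by positivity
  obtain ⟨D, hD, hVolt⟩ := exists_volterra_bound hA hω
  obtain ⟨Cₑ, hCe0, hCe⟩ := exp_neg_mul_rpow_le hη₀ hβ0
  set G : ℝ := Cₑ * (κ ^ 2 * R + R) ^ 2
    + κ ^ 2 * D * (η₀ ^ 2 * (κ ^ 2 * Cₑ + 4 * (κ ^ 2 + 2 * c * η₀ ^ (γ - 1)))) with hG
  have hG0 : 0 < G := by positivity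
  -- The outer split at `p` contributes a factor `2`; `1 + log T ≤ 3 log T` makes it `6 G`, and `1 ≤
  -- 2 log T` turns `2 R²` into `4 R²`.
  refine ⟨6 * G + 4 * R ^ 2, by positivity, ?_⟩
  intro X _ _ V _ ρ _ μ _ φ K hy hF hB hsrc hcap hS T hT
  obtain ⟨g, hg, hgf⟩ := hsrc
  have hclip := hB.ae_eq_clip hκ0.le hF.measurable_feature
  -- The features are bounded only almost everywhere; truncation supplies a pointwise bound without
  -- changing the expected error.
  rw [lintegral_sqDist_congr hclip]
  set L := integralOp ρ.fst K with hLdef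
  set h := operatorPow L ζ g with hhdef
  have M : IsModel ρ μ (clip κ φ) κ L h :=
    { measurable := measurable_clip hF.measurable_feature
      abs_le := abs_clip_le hκ0.le
      pos := hκ0
      inner_eq := inner_integralOp (hF.isBoundedKernel hB) (measurable_clip hF.measurable_feature)
        (abs_clip_le hκ0.le) (hF.ae_kernel_eq hclip)
      coe_eq := hgf
      integrable_sq := hy }
  have hT1 : (1 : ℝ) ≤ T := by exact_mod_cast (by omega : 1 ≤ T)
  have hT0 : (0 : ℝ) < T := by linarith
  rw [hlamexp]
  set lam : ℝ := (T : ℝ) ^ (θ - 1 + β) with hlam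
  have hlam0 : 0 < lam := by positivity
  have hlam1 : lam ≤ 1 := Real.rpow_le_one_of_one_le_of_nonpos hT1 hβθ
  set p := regularized L lam h with hpdef
  have hp : L p + lam • p = L h := map_regularized_add M.isPositive hlam0 h
  have hph : ‖p - h‖ ≤ lam ^ ζ * R := by
    rw [hpdef, regularized_sub M.isPositive hlam0, norm_neg]
    exact (norm_smul_inverse_operatorPow_le M.isPositive hlam0 hζ0.le hζ1 g).trans
      (mul_le_mul_of_nonneg_left hg (by positivity))
  have hlamζ : lam ^ ζ ≤ 1 := Real.rpow_le_one hlam0.le hlam1 hζ0.le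
  have hphR : ‖p - h‖ ≤ R := hph.trans (mul_le_of_le_one_left hR.le hlamζ)
  have hh : ‖h‖ ≤ κ ^ 2 * R := by
    refine (norm_operatorPow_le M.isPositive (sq_nonneg κ) M.inner_map_self_le hζ0.le g).trans ?_
    refine mul_le_mul ?_ hg (norm_nonneg _) (sq_nonneg κ)
    calc (κ ^ 2) ^ ζ ≤ (κ ^ 2) ^ (1 : ℝ) := Real.rpow_le_rpow_of_exponent_le hκ2 hζ1
      _ = κ ^ 2 := Real.rpow_one _
  have hpn : ‖p‖ ≤ κ ^ 2 * R + R := by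
    have e : p = h + (p - h) := by abel
    rw [e]
    exact (norm_add_le _ _).trans (add_le_add hh hphR)
  have hpn2 : ‖p‖ ^ 2 ≤ (κ ^ 2 * R + R) ^ 2 := pow_le_pow_left₀ (norm_nonneg _) hpn 2
  have hηm : ∀ j : ℕ, 1 ≤ j → η₀ * (j : ℝ) ^ (-θ) * (κ ^ 2 + 2 * lam) ≤ 1 := by
    intro j hj
    have hj1 : (1 : ℝ) ≤ j := by exact_mod_cast hj
    have h1 : (j : ℝ) ^ (-θ) ≤ 1 := Real.rpow_le_one_of_one_le_of_nonpos hj1 (by linarith)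
    calc _ ≤ η₀ * 1 * (κ ^ 2 + 2 * 1) := by gcongr
      _ ≤ 1 := by linarith
  have hAle : 4 * ‖p‖ ^ 2 + (4 * ‖p - h‖ ^ 2 + 2 * S) ≤ A := by
    have h1 : ‖p - h‖ ^ 2 ≤ R ^ 2 := pow_le_pow_left₀ (norm_nonneg _) hphR 2
    have h2 := le_abs_self S
    linarith
  -- `D` was fixed before `T` and the measures; this is legitimate because the weights and `A` do
  -- not depend on them.
  have hrisk := hVolt (meanRisk ρ μ (clip κ φ) (fun i : ℕ => η₀ * (i : ℝ) ^ (-θ)) lam) _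
    (fun j t hjt => by
      have h1 : (j : ℝ) ≤ t := by exact_mod_cast hjt
      have h2 : 0 ≤ (t : ℝ) + 1 - j := by linarith
      positivity)
    (sum_weight_le hη₀ hθ0.le hγ0 hγ1 hc.le)
    (M.meanRisk_le_sum hη₀ hθ0.le hγ0 hγ1 hc.le hlam0.le hηm hcap hp hS hAle)
  have hmain := M.meanSqDist_le_rate hη₀ hθ0.le hθ1.le hγ0 hγ1 hc.le hα hα1 (by omega : 1 ≤ T)
    hlam hηm hcap hp hD.le hrisk (hCe T hT1)
  refine (lintegral_sqDist_le (p := p) M.measurable M.abs_le M.coe_eq T).trans ?_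
  refine (add_le_add (mul_le_mul_right hmain _) le_rfl).trans ?_
  have hlogT : 0 ≤ Real.log T := Real.log_nonneg hT1
  rw [← ENNReal.ofReal_mul (by norm_num), ← ENNReal.ofReal_add (by positivity) (by positivity)]
  refine ENNReal.ofReal_le_ofReal ?_
  -- `T ≥ 2` enters here: it lets the logarithm absorb additive constants.
  have hlog2 : 1 / 2 ≤ Real.log T := by
    have h1 : Real.log 2 ≤ Real.log T :=
      Real.log_le_log (by norm_num) (by exact_mod_cast hT)
    linarith [Real.log_two_gt_d9]
  have hTε : (T : ℝ) ^ (-α) ≤ (T : ℝ) ^ (-α + ε) :=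
    Real.rpow_le_rpow_of_exponent_le hT1 (by linarith)
  have hbias : ‖p - h‖ ^ 2 ≤ R ^ 2 * (T : ℝ) ^ (-α + ε) := by
    refine (pow_le_pow_left₀ (norm_nonneg _) hph 2).trans (le_of_eq ?_)
    rw [mul_pow, ← Real.rpow_mul_natCast hlam0.le, hlam, ← Real.rpow_mul hT0.le, ← hαβ, mul_comm]
    congr 2
    push_cast
    ring
  have hvar : (Cₑ * ‖p‖ ^ 2
        + κ ^ 2 * D * (η₀ ^ 2 * (κ ^ 2 * Cₑ + 4 * (κ ^ 2 + 2 * c * η₀ ^ (γ - 1)))))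
          * ((T : ℝ) ^ (-α) * (1 + Real.log T)) ≤
      G * ((T : ℝ) ^ (-α + ε) * (3 * Real.log T)) := by
    rw [hG]
    gcongr
    linarith
  have hR2 : R ^ 2 * (T : ℝ) ^ (-α + ε) ≤ R ^ 2 * (T : ℝ) ^ (-α + ε) * (2 * Real.log T) :=
    le_mul_of_one_le_right (by positivity) (by linarith)
  linarith
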